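/- Let $k<0$ and $n\ge 1$. Consider the billiard with repelling Hooke potential on the table $\Omega_n$ obtained from $n$ copies of the closed unit disk $D\subset\mathbb R^2$ by gluing them along their boundary circles by the cyclic permutation $\sigma=(1\,2\,\dots\,n)$. Its phase space is the quotient of $\{1,\dots,n\}\times D\times\mathbb R^2$ (sheet, position $x$, velocity $v$) in which, for $|x|=1$ and $\langle x,v\rangle\ge 0$, the point $(i,x,v)$ is identified with $(\sigma(i),x,v-2\langle x,v\rangle x)$. Its first integrals are $$H=\tfrac12|v|^2+\tfrac k2|x|^2,\qquad F=x_1v_2-x_2v_1 .$$ (1) The monodromy label of the singularity over the point $(h,f)=(0,0)$ equals $n$. Here the label is the number $m\in\mathbb Z_{\ge0}$ such that along closed paths close to $(0,0)$ that make one turn around it the monodromy matrix is $\begin{pmatrix}1&0\\ m&1\end{pmatrix}$ in a suitable basis of cycles on the fibre. More precisely, over every closed path in $\{(h,f): h>(f^2+k)/2\}\setminus\{(0,0)\}$ that makes one turn around $(0,0)$ the fibres of $(H,F)$ are tori, and in a suitable basis $(\lambda,\mu)$ of cycles the monodromy is $\begin{pmatrix}\lambda'\\ \mu'\end{pmatrix}=\begin{pmatrix}1&0\\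 n&1\end{pmatrix}\begin{pmatrix}\lambda\\ \mu\end{pmatrix}$. (2) For $k/2<h<0$ the Fomenko–Zieschang invariant of the isoenergy surface $Q^3_h=\{H=h\}$ is the molecule $A-A$ with marks $r=\infty$, $\varepsilon=1$, and $Q^3_h$ is homeomorphic to $S^1\times S^2$. (3) For $h>0$ the Fomenko–Zieschang invariant of $Q^3_h$, for a suitable orientation of $Q^3_h$, is the molecule $A-A$ with marks $r=1/n \bmod 1$, $\varepsilon=1$, and $Q^3_h$ is homeomorphic to the lens space $L(n,1)$, the quotient of $S^3\subset\mathbb C^2$ by $(z,w)\mapsto(\zeta z,\zeta w)$, $\zeta^n=1$ (so $S^3$ for $n=1$). In (2) and (3) the marks are those of a gluing matrix $\begin{pmatrix}\lambda_+\\ \mu_+\end{pmatrix}=\begin{pmatrix}\alpha&\beta\\ \gamma&\delta\end{pmatrix}\begin{pmatrix}\lambda_-\\ \mu_-\end{pmatrix}$ of determinant $-1$ between admissible bases on a torus that cuts $Q^3_h$ into the two solid tori $F\le f_0$ and $F\ge f_0$ foliated by concentric tori: $\lambda_\pm$ is a meridian, and $\mu_\pm$ completes it to a basis and is oriented by the motion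 along the critical circle; $r=\alpha/\beta \bmod 1$ and $\varepsilon=\operatorname{sign}\beta$ if $\beta\neq0$, while $r=\infty$ and $\varepsilon=\operatorname{sign}\alpha$ if $\beta=0$. -/

import Mathlib

open Set Topology

namespace HookeBilliard

noncomputable section

/-! ### The billiard book and its phase space

The plane is identified with `ℂ` (Euclidean norm), the table `D` is the closed unit disk. -/

/-- The closed unit disk `D`. -/
abbrev Disk : Type := Metric.closedBall (0 : ℂ) 1

/-- Triples (sheet, position, velocity) on `n` copies of the disk, before gluing. -/
abbrev PrePhase (n : ℕ) : Type := Fin n × Disk × ℂ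

/-- Elastic reflection of the velocity `v` at the point `x` of the unit circle. -/
def reflect (x v : ℂ) : ℂ := v - (2 * (x.re * v.re + x.im * v.im) : ℝ) • x

/-- A ball on sheet `i` that reaches the boundary at `x` with velocity `v` not directed strictly
inwards (`0 ≤ ⟨x, v⟩`) continues on sheet `σ i` with the reflected velocity. For tangent `v` the
reflected velocity is `v` itself, so that all sheets of a cycle of `σ` are identified there. -/
def Glue {n : ℕ} (σ : Equiv.Perm (Fin n)) (a b : PrePhase n) : Prop :=
  ‖(a.2.1 : ℂ)‖ = 1 ∧ 0 ≤ (a.2.1 : ℂ).re * a.2.2.re + (a.2.1 : ℂ).im * a.2.2.im ∧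
    b = (σ a.1, a.2.1, reflect a.2.1 a.2.2)

/-- Phase space (with the quotient topology) of the billiard book made of `n` disks that are glued
along their boundary circles by the permutation `σ`. -/
abbrev Book {n : ℕ} (σ : Equiv.Perm (Fin n)) : Type := Quot (Glue σ)

/-- Phase space of the billiard on `Ω_n`: `n` disks and the cyclic permutation `(1 2 … n)`. -/
abbrev Phase (n : ℕ) : Type := Book (finRotate n)

theorem normSq_reflect {x : ℂ} (hx : ‖x‖ = 1) (v : ℂ) : ‖reflect x v‖ ^ 2 = ‖v‖ ^ 2 := by
  have h1 : x.re * x.re + x.im * x.im = 1 := by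
    have := Complex.sq_norm x
    rw [hx, Complex.normSq_apply] at this
    linarith
  rw [Complex.sq_norm, Complex.sq_norm, Complex.normSq_apply, Complex.normSq_apply]
  simp only [reflect, Complex.sub_re, Complex.sub_im, Complex.real_smul, Complex.mul_re,
    Complex.mul_im, Complex.ofReal_re, Complex.ofReal_im, zero_mul, sub_zero, add_zero]
  linear_combination (4 * (x.re * v.re + x.im * v.im) ^ 2) * h1

/-- The energy `H = |v|² / 2 + k |x|² / 2`. -/
def energy {n : ℕ} (k : ℝ) (σ : Equiv.Perm (Fin n)) : Book σ → ℝ :=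
  Quot.lift (fun a => ‖a.2.2‖ ^ 2 / 2 + k / 2 * ‖(a.2.1 : ℂ)‖ ^ 2) (by
    rintro a b ⟨h1, -, rfl⟩
    simp only [normSq_reflect h1])

/-- The integral `F = x ẏ - y ẋ`. -/
def angMom {n : ℕ} (σ : Equiv.Perm (Fin n)) : Book σ → ℝ :=
  Quot.lift (fun a => (a.2.1 : ℂ).re * a.2.2.im - (a.2.1 : ℂ).im * a.2.2.re) (by
    rintro a b ⟨h1, -, rfl⟩
    simp only [reflect, Complex.sub_re, Complex.sub_im, Complex.real_smul, Complex.mul_re,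
      Complex.mul_im, Complex.ofReal_re, Complex.ofReal_im, zero_mul, sub_zero, add_zero]
    ring)

/-- The momentum map `(H, F)` of the billiard on `Ω_n`. -/
def momentum (n : ℕ) (k : ℝ) (P : Phase n) : ℝ × ℝ :=
  (energy k (finRotate n) P, angMom (finRotate n) P)

/-- The isoenergy surface `Q³_h`. -/
abbrev Isoenergy (n : ℕ) (k h : ℝ) : Type := {P : Phase n // (momentum n k P).1 = h}

/-! ### Cycles on tori -/

/-- The two loops `a`, `b` are freely homotopic inside `S`. If `S` is a torus, this means that
they have the same class in `H₁(S; ℤ)`, because the fundamental group of `S` is abelian. -/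
def FreelyHomotopicIn {M : Type*} [TopologicalSpace M] (S : Set M) (a b : Circle → M) : Prop :=
  ∃ K : C(unitInterval × Circle, M),
    (∀ z, K (0, z) = a z) ∧ (∀ z, K (1, z) = b z) ∧ ∀ p, K p ∈ S

/-- If `e` parametrizes a torus with basic cycles `lam = e (·, 1)` and `mu = e (1, ·)`, this is a
loop in the class `a lam + b mu`. -/
def cycle {M : Type*} (e : Circle × Circle → M) (a b : ℤ) : Circle → M :=
  fun z => e (z ^ a, z ^ b)

/-- Two parametrizations `e`, `e'` of the torus `S`: the basis `(lam', mu')` of `e'` is expressed by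
the basis `(lam, mu)` of `e` as `lam' = A₀₀ lam + A₀₁ mu`, `mu' = A₁₀ lam + A₁₁ mu`. -/
def IsTransition {M : Type*} [TopologicalSpace M] (S : Set M) (e e' : Circle × Circle → M)
    (A : Matrix (Fin 2) (Fin 2) ℤ) : Prop :=
  FreelyHomotopicIn S (cycle e' 1 0) (cycle e (A 0 0) (A 0 1)) ∧
  FreelyHomotopicIn S (cycle e' 0 1) (cycle e (A 1 0) (A 1 1))

/-! ### Monodromy -/

/-- `γ` is a closed path in the plane that makes exactly one turn (in either direction) around `p`
and does not meet `p`: in polar coordinates centred at `p` its angle changes by `± 2π`. -/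
def TurnsOnceAround (p : ℝ × ℝ) (γ : C(unitInterval, ℝ × ℝ)) : Prop :=
  ∃ ρ θ : C(unitInterval, ℝ), (∀ t, 0 < ρ t) ∧ ρ 1 = ρ 0 ∧ |θ 1 - θ 0| = 2 * Real.pi ∧
    ∀ t, γ t = (p.1 + ρ t * Real.cos (θ t), p.2 + ρ t * Real.sin (θ t))

/-- `A` is the monodromy matrix, in a suitable basis of cycles, of the fibration by tori that the
map `𝓕` defines over the closed path `γ`: the fibres over `γ` are tori, carrying parametrizations
`Φ (t, ·)` and hence bases of cycles `(lam_t, mu_t)` that depend continuously on `t`, and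
`(lam_1, mu_1)ᵀ = A (lam_0, mu_0)ᵀ` on the fibre over `γ 1 = γ 0`. -/
def HasMonodromy {M : Type*} [TopologicalSpace M] (𝓕 : M → ℝ × ℝ)
    (γ : C(unitInterval, ℝ × ℝ)) (A : Matrix (Fin 2) (Fin 2) ℤ) : Prop :=
  ∃ Φ : C(unitInterval × (Circle × Circle), M),
    (∀ t, IsEmbedding (fun z => Φ (t, z)) ∧ range (fun z => Φ (t, z)) = 𝓕 ⁻¹' {γ t}) ∧
    IsTransition (𝓕 ⁻¹' {γ 0}) (fun z => Φ (0, z)) (fun z => Φ (1, z)) A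

/-- `m` is the monodromy label of the singularity of `𝓕` over the isolated point `p`: along the
closed paths that make one turn around `p`, close to `p`, the monodromy matrix is
`(1 0; m 1)` in a suitable basis of cycles. -/
def IsMonodromyLabel {M : Type*} [TopologicalSpace M] (𝓕 : M → ℝ × ℝ) (p : ℝ × ℝ) (m : ℕ) :
    Prop :=
  ∃ U ∈ 𝓝 p, ∀ γ : C(unitInterval, ℝ × ℝ), TurnsOnceAround p γ → (∀ t, γ t ∈ U) →
    HasMonodromy 𝓕 γ !![1, 0; (m : ℤ), 1]

/-! ### The marked molecule `A – A` -/

/-- The solid torus. -/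
abbrev SolidTorus : Type := Disk × Circle

/-- Its boundary torus; the cycle `lam` (first factor) is the meridian, which is contractible in the
solid torus, and `mu` (second factor) completes it to a basis. -/
def bdry (z : Circle × Circle) : SolidTorus :=
  (⟨(z.1 : ℂ), by rw [mem_closedBall_zero_iff, Circle.norm_coe]⟩, z.2)

/-- `V` identifies the part `S` of phase space with a solid torus such that the level sets of `F`
in `S` are the concentric tori (3-atom `A`) and the core circle (the critical circle) is oriented by
the motion of the ball, along which the velocity is the time derivative of the position. -/
structure IsAtomA {n : ℕ} (V : SolidTorus → Phase n) (S : Set (Phase n)) : Prop where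
  isEmbedding : IsEmbedding V
  range_eq : range V = S
  leaves : ∀ p q : SolidTorus,
    angMom (finRotate n) (V p) = angMom (finRotate n) (V q) ↔ ‖(p.1 : ℂ)‖ = ‖(q.1 : ℂ)‖
  core : ∃ ω : ℝ, 0 < ω ∧ ∃ c : ℝ → PrePhase n, ∀ t : ℝ,
    V (⟨0, by simp⟩, Circle.exp (ω * t)) = Quot.mk _ (c t) ∧
    HasDerivAt (fun s => ((c s).2.1 : ℂ)) (c t).2.2 t

/-- The Liouville foliation of the isoenergy surface `Q³_h` has the molecule `A – A` with gluing
matrix `C` in admissible bases: some level `F = f₀` cuts `Q³_h` into two solid tori `V₋`, `V₊`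
(the atoms `A`), `lam₋`, `lam₊` are their meridians, `mu₋`, `mu₊` are oriented by the motion along
the critical circles, and `(lam₊, mu₊)ᵀ = C (lam₋, mu₋)ᵀ`. The condition `det C = -1` says that
both bases are admissible with respect to one orientation of `Q³_h`. -/
def HasMoleculeAA (n : ℕ) (k h : ℝ) (C : Matrix (Fin 2) (Fin 2) ℤ) : Prop :=
  ∃ (f₀ : ℝ) (Vm Vp : SolidTorus → Phase n),
    IsAtomA Vm {P | (momentum n k P).1 = h ∧ (momentum n k P).2 ≤ f₀} ∧
    IsAtomA Vp {P | (momentum n k P).1 = h ∧ f₀ ≤ (momentum n k P).2} ∧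
    C.det = -1 ∧
    IsTransition (momentum n k ⁻¹' {(h, f₀)}) (Vm ∘ bdry) (Vp ∘ bdry) C

/-- The mark `r ∈ ℚ/ℤ ∪ {∞}` of a gluing matrix `(α β; γ δ)`: `α / β mod 1`, or `∞` if `β = 0`. -/
def markR (C : Matrix (Fin 2) (Fin 2) ℤ) : WithTop (AddCircle (1 : ℚ)) :=
  if C 0 1 = 0 then ⊤ else (((C 0 0 / C 0 1 : ℚ) : AddCircle (1 : ℚ)) : WithTop _)

/-- The mark `ε` of a gluing matrix `(α β; γ δ)`: `sign β`, or `sign α` if `β = 0`. -/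
def markEps (C : Matrix (Fin 2) (Fin 2) ℤ) : ℤ :=
  if C 0 1 = 0 then (C 0 0).sign else (C 0 1).sign

/-! ### Model three-manifolds -/

/-- The unit sphere `S³` in `ℂ²`. -/
abbrev S3 : Type := {z : ℂ × ℂ // ‖z.1‖ ^ 2 + ‖z.2‖ ^ 2 = 1}

/-- The lens space `L(p, q)`: the quotient of `S³ ⊆ ℂ²` by `(z, w) ↦ (ζ z, ζ ^ q w)`, `ζ ^ p = 1`. -/
abbrev LensSpace (p q : ℕ) : Type :=
  Quot fun a b : S3 => ∃ ζ : ℂ, ζ ^ p = 1 ∧ b.1.1 = ζ * a.1.1 ∧ b.1.2 = ζ ^ q * a.1.2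

/-- The unit sphere `S²`. -/
abbrev S2 : Type := Metric.sphere (0 : EuclideanSpace ℝ (Fin 3)) 1

end

end HookeBilliard

/-!
Put `k = -κ²`. Inside a disk the ball moves by `x'' = κ² x`, and the expanding component
`p = v + κ x` and the contracting component `q = v - κ x` satisfy `conj p * q = 2 H + 2 i κ F`
(`conj_expanding_mul`). Hence `p ≠ 0` away from the singular value `(0, 0)`. In one disk, a fibre
of `(H, F) = (h, f)` with `s = √(2h + κ² - f²) > 0` is a cylinder whose coordinates are the radial
velocity `⟨x, v⟩ ∈ [-s, s]` and the direction of `p` (`state_ext`, `exists_state`); the two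
boundary circles `⟨x, v⟩ = ± s` are the states on the unit circle, and there
`p = x (κ ± s + i f)`.

Passing from the exit of one sheet to the entry of the next, the direction of `p` jumps by the
quotient of the directions of `κ - s + i f` and `κ + s + i f`. Let `A` be an argument of
`κ - s + i f`. Turning the direction of `p` back by an angle that runs from `A` to the argument of
`κ + s + i f` on each sheet gives the rotation angle `gauge`, which equals the position `x` at
collisions and therefore is continuous on phase space. Together with the progress `phase` of the
ball through the `n` sheets it identifies the fibre with a torus (`mk_eq_iff`, `exists_of_gauge`).
Everything now depends on the choice of `A`: replacing `A` by `A + 2π` multiplies `gauge` by the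
`n`-th power of `phase` (`gauge_add_two_pi`).

* Along a loop around `(0, 0)` the vector `κ - s + i f` makes one turn
  (`entry_mul_mem_slitPlane`), so `A` changes by `± 2π`. This is the monodromy
  (`exists_transport`). The label is unique because another continuous choice of bases conjugates
  the monodromy matrix by an invertible integer matrix, which is read off from winding numbers
  (`label_unique`).
* For `h < 0` the vector `κ - s + i f` avoids the negative real axis, and one branch of `A` serves
  the whole isoenergy surface (`isEntryBranch_of_neg`). At the tangent states `s = 0` only the
  rotation angle survives. So `F ≥ 0` and `F ≤ 0` are solid tori with the same meridian, and the
  surface is a product of a circle and a sphere with height `F`.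
* For `h > 0` the branch that extends over the tangent states with `F > 0` and the branch that
  extends over those with `F < 0` differ by `2π` (`isEntryBranch_of_pos`). So the meridian on one
  side is the meridian on the other side plus `n` times the rotation cycle. For the point `(z, w)`
  of the three-sphere with progress `(z / |z|) / (w / |w|)`, the two rotation angles are
  `(z / |z|) ^ n` and `(w / |w|) ^ n`, which are functions on the lens space
  (`exists_stateInvariants_eq`).

All maps are constructed in the direction out of the sheets, where continuity can be checked sheet
by sheet, and then inverted by compactness (`exists_isEmbedding_of_quotient`).
-/

namespace HookeBilliard

noncomputable section

/-! ### Maps out of compact spaces -/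

/-- Two continuous maps out of a compact space with the same fibres have homeomorphic images. This
turns coordinate functions `q` into a parametrization `V` of the image of `j`. -/
theorem exists_isEmbedding_of_quotient {K T M : Type*} [TopologicalSpace K] [TopologicalSpace T]
    [TopologicalSpace M] [CompactSpace K] [T2Space T] [T2Space M] {q : K → T} {j : K → M}
    (hq : Continuous q) (hs : Function.Surjective q) (hj : Continuous j)
    (h : ∀ a b, q a = q b ↔ j a = j b) :
    ∃ V : T → M, IsEmbedding V ∧ range V = range j ∧ ∀ a, V (q a) = j a := by
  have hcT : CompactSpace T := ⟨hs.range_eq ▸ isCompact_range hq⟩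
  have hqm : IsQuotientMap q := hq.isClosedMap.isQuotientMap hq hs
  set V : T → M := fun t => j (Function.surjInv hs t)
  have hV : ∀ a, V (q a) = j a := fun a => (h _ _).1 (Function.surjInv_eq hs (q a))
  have hVc : Continuous V := hqm.continuous_iff.2 (by
    have : V ∘ q = j := funext hV
    rwa [this])
  refine ⟨V, (hVc.isClosedEmbedding ?_).isEmbedding, ?_, hV⟩
  · intro t s hts
    obtain ⟨a, rfl⟩ := hs t
    obtain ⟨b, rfl⟩ := hs s
    rw [hV, hV] at hts
    exact (h a b).2 hts
  · rw [← hs.range_comp V]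
    congr 1
    exact funext hV

/-- Version of `exists_isEmbedding_of_quotient` for maps that are continuous on a compact set. -/
theorem exists_isEmbedding_of_continuousOn {X T M : Type*} [TopologicalSpace X]
    [TopologicalSpace T] [TopologicalSpace M] [T2Space T] [T2Space M] {K : Set X}
    (hK : IsCompact K) {q : X → T} {j : X → M}
    (hq : ContinuousOn q K) (hs : ∀ t, ∃ a ∈ K, q a = t) (hj : ContinuousOn j K)
    (h : ∀ a ∈ K, ∀ b ∈ K, (q a = q b ↔ j a = j b)) :
    ∃ V : T → M, IsEmbedding V ∧ range V = j '' K ∧ ∀ a ∈ K, V (q a) = j a := by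
  have : CompactSpace K := isCompact_iff_compactSpace.1 hK
  obtain ⟨V, h1, h2, h3⟩ := exists_isEmbedding_of_quotient (q := K.domRestrict q)
    (j := K.domRestrict j)
    hq.domRestrict (fun t => by obtain ⟨a, ha, rfl⟩ := hs t; exact ⟨⟨a, ha⟩, rfl⟩) hj.domRestrict
    (fun a b => h a a.2 b b.2)
  refine ⟨V, h1, by rw [h2, range_domRestrict], fun a ha => h3 ⟨a, ha⟩⟩

/-- A factor that vanishes at a point makes up for a discontinuity there of a bounded function. -/
theorem continuousWithinAt_smul_of_bounded {X E : Type*} [TopologicalSpace X]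
    [NormedAddCommGroup E] [NormedSpace ℝ E] {s : Set X} {x : X} {d : X → ℝ} {g : X → E} (C : ℝ)
    (hd : ContinuousWithinAt d s x) (hb : ∀ y, ‖g y‖ ≤ C)
    (hg : d x ≠ 0 → ContinuousWithinAt g s x) : ContinuousWithinAt (fun y => d y • g y) s x := by
  by_cases h : d x = 0
  · unfold ContinuousWithinAt at hd ⊢
    beta_reduce
    rw [h] at hd ⊢
    rw [zero_smul]
    exact hd.zero_smul_isBoundedUnder_le (Filter.isBoundedUnder_of ⟨C, hb⟩)
  · exact hd.smul (hg h)

/-! ### Directions of complex numbers -/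

/-- The direction `z / |z|` of a complex number (`1` for `z = 0`). -/
def dir (z : ℂ) : Circle := Circle.exp z.arg

theorem norm_mul_dir (z : ℂ) : (‖z‖ : ℂ) * dir z = z := by
  simp [dir, Circle.coe_exp, Complex.norm_mul_exp_arg_mul_I]

theorem dir_eq_of_mul {z : ℂ} {r : ℝ} {d : Circle} (hr : 0 < r) (h : z = r * d) : dir z = d := by
  have hn : ‖z‖ = r := by rw [h]; simp [abs_of_pos hr, Circle.norm_coe]
  have h1 := norm_mul_dir z
  rw [hn] at h1
  have h2 : (r : ℂ) * dir z = r * d := h1.trans h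
  exact Circle.ext (mul_left_cancel₀ (by exact_mod_cast hr.ne') h2)

theorem dir_mul {z w : ℂ} (hz : z ≠ 0) (hw : w ≠ 0) : dir (z * w) = dir z * dir w := by
  refine dir_eq_of_mul (r := ‖z‖ * ‖w‖) (by positivity) ?_
  conv_lhs => rw [← norm_mul_dir z, ← norm_mul_dir w]
  push_cast
  ring

theorem dir_coe (z : Circle) : dir (z : ℂ) = z := dir_eq_of_mul one_pos (by simp)

theorem dir_circle_mul (d : Circle) {z : ℂ} (hz : z ≠ 0) : dir (d * z) = d * dir z := by
  rw [dir_mul d.coe_ne_zero hz, dir_coe]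

theorem dir_neg {z : ℂ} (hz : z ≠ 0) : dir (-z) = Circle.exp Real.pi * dir z := by
  rw [← dir_circle_mul _ hz]
  simp [Circle.coe_exp]

theorem dir_conj {z : ℂ} (hz : z ≠ 0) : dir (starRingEnd ℂ z) = (dir z)⁻¹ := by
  refine dir_eq_of_mul (norm_pos_iff.2 hz) ?_
  rw [Circle.coe_inv_eq_conj]
  conv_lhs => rw [← norm_mul_dir z]
  simp

theorem isEmbedding_circle_coe : IsEmbedding (fun z : Circle => (z : ℂ)) :=
  IsEmbedding.subtypeVal

theorem continuousAt_dir {z : ℂ} (hz : z ≠ 0) : ContinuousAt dir z := by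
  rw [ContinuousAt, isEmbedding_circle_coe.tendsto_nhds_iff]
  have h : ContinuousAt (fun w : ℂ => w / (‖w‖ : ℂ)) z := by
    refine continuousAt_id.div (by fun_prop) (by simpa using hz)
  have he : ((fun c : Circle => (c : ℂ)) ∘ dir) =ᶠ[𝓝 z] fun w : ℂ => w / (‖w‖ : ℂ) := by
    filter_upwards [isOpen_ne.mem_nhds hz] with w hw
    have : (‖w‖ : ℂ) ≠ 0 := by simpa using hw
    rw [eq_div_iff this, mul_comm]
    exact norm_mul_dir w
  have := h.congr he.symm
  exact this

theorem exp_arg_eq_dir (z : ℂ) : Circle.exp z.arg = dir z := rfl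

theorem exists_pow_eq {n : ℕ} (hn : 0 < n) (z : Circle) : ∃ w : Circle, w ^ n = z := by
  refine ⟨Circle.exp ((z : ℂ).arg / n), ?_⟩
  rw [← Circle.exp_natCast_mul]
  rw [mul_div_cancel₀ _ (by positivity), Circle.exp_arg]

section

/-! ### The motion inside one disk -/

/-- The radial part `⟨x, v⟩` of the velocity (times `|x|`). -/
def rad (x v : ℂ) : ℝ := x.re * v.re + x.im * v.im

/-- The angular momentum of the state `(x, v)`. -/
def ang (x v : ℂ) : ℝ := x.re * v.im - x.im * v.re

/-- The energy of the state `(x, v)` for the Hooke constant `k = -κ ^ 2`. -/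
def nrg (κ : ℝ) (x v : ℂ) : ℝ := ‖v‖ ^ 2 / 2 + -κ ^ 2 / 2 * ‖x‖ ^ 2

/-- The radial speed `√(2h + κ² - f²)` with which a ball of energy `h` and angular momentum `f`
hits the boundary circle. -/
def impact (κ h f : ℝ) : ℝ := √(2 * h + κ ^ 2 - f ^ 2)

/-- The expanding eigencomponent `v + κ x` of the linear flow `x'' = κ² x`. -/
def expanding (κ : ℝ) (x v : ℂ) : ℂ := v + κ * x

theorem sq_norm_eq (z : ℂ) : ‖z‖ ^ 2 = z.re ^ 2 + z.im ^ 2 := by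
  rw [Complex.sq_norm, Complex.normSq_apply]; ring

variable {κ h f : ℝ} {x v : ℂ}

theorem impact_nonneg : 0 ≤ impact κ h f := Real.sqrt_nonneg _

theorem rad_sq_add (κ : ℝ) (x v : ℂ) :
    2 * nrg κ x v + κ ^ 2 - ang x v ^ 2 =
      rad x v ^ 2 + (1 - ‖x‖ ^ 2) * (‖v‖ ^ 2 + κ ^ 2) := by
  simp only [nrg, ang, rad, sq_norm_eq]
  ring

theorem discr_nonneg (hx : ‖x‖ ≤ 1) : 0 ≤ 2 * nrg κ x v + κ ^ 2 - ang x v ^ 2 := by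
  rw [rad_sq_add]
  have : 0 ≤ 1 - ‖x‖ ^ 2 := by nlinarith [norm_nonneg x]
  positivity

/-- In particular the radial velocity is at most the impact speed, and equality characterizes the
states on the boundary circle. -/
theorem impact_sq (hx : ‖x‖ ≤ 1) :
    impact κ (nrg κ x v) (ang x v) ^ 2 = rad x v ^ 2 + (1 - ‖x‖ ^ 2) * (‖v‖ ^ 2 + κ ^ 2) := by
  rw [impact, Real.sq_sqrt (discr_nonneg hx), rad_sq_add]

theorem abs_rad_le_impact (hx : ‖x‖ ≤ 1) : |rad x v| ≤ impact κ (nrg κ x v) (ang x v) := by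
  refine abs_le_of_sq_le_sq ?_ impact_nonneg
  rw [impact_sq hx]
  have : 0 ≤ 1 - ‖x‖ ^ 2 := by nlinarith [norm_nonneg x]
  nlinarith [mul_nonneg this (by positivity : 0 ≤ ‖v‖ ^ 2 + κ ^ 2)]

theorem norm_eq_one_of_rad_sq (hκ : 0 < κ) (hx : ‖x‖ ≤ 1)
    (hr : rad x v ^ 2 = impact κ (nrg κ x v) (ang x v) ^ 2) : ‖x‖ = 1 := by
  rw [impact_sq hx] at hr
  have h0 : (1 - ‖x‖ ^ 2) * (‖v‖ ^ 2 + κ ^ 2) = 0 := by linarith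
  have h1 : 1 - ‖x‖ ^ 2 = 0 := (mul_eq_zero.1 h0).resolve_right (by positivity)
  nlinarith [norm_nonneg x]

theorem impact_eq_abs_rad (hx : ‖x‖ = 1) : impact κ (nrg κ x v) (ang x v) = |rad x v| := by
  rw [← abs_of_nonneg (impact_nonneg (κ := κ)), ← sq_eq_sq_iff_abs_eq_abs, impact_sq hx.le, hx]
  ring

theorem eq_mul_of_norm_eq_one (hx : ‖x‖ = 1) : v = x * ⟨rad x v, ang x v⟩ := by
  have h1 : x.re ^ 2 + x.im ^ 2 = 1 := by rw [← sq_norm_eq, hx]; norm_num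
  apply Complex.ext
  · simp only [rad, ang, Complex.mul_re]
    linear_combination -v.re * h1
  · simp only [rad, ang, Complex.mul_im]
    linear_combination -v.im * h1

/-- At a collision, the expanding component is obtained from the position by a factor that depends
only on the radial velocity and the angular momentum. -/
theorem expanding_of_norm_eq_one (hx : ‖x‖ = 1) :
    expanding κ x v = x * ⟨κ + rad x v, ang x v⟩ := by
  have := eq_mul_of_norm_eq_one (v := v) hx
  rw [expanding]
  nth_rw 1 [this]
  have h2 : (⟨κ + rad x v, ang x v⟩ : ℂ) = ⟨rad x v, ang x v⟩ + κ := by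
    apply Complex.ext <;> simp [add_comm]
  rw [h2]; ring

/-- The product of the expanding component and the conjugate contracting component `v - κ x`
encodes both first integrals. -/
theorem conj_expanding_mul (κ : ℝ) (x v : ℂ) :
    starRingEnd ℂ (expanding κ x v) * (v - κ * x) = ⟨2 * nrg κ x v, 2 * κ * ang x v⟩ := by
  apply Complex.ext
  · simp [expanding, nrg, sq_norm_eq]; ring
  · simp [expanding, ang]; ring

theorem expanding_ne_zero (hκ : 0 < κ) (hne : (nrg κ x v, ang x v) ≠ (0, 0)) :
    expanding κ x v ≠ 0 := by
  intro h0
  have := conj_expanding_mul κ x v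
  rw [h0, map_zero, zero_mul] at this
  have h1 := congrArg Complex.re this
  have h2 := congrArg Complex.im this
  simp only [Complex.zero_re, Complex.zero_im] at h1 h2
  apply hne
  rw [Prod.mk.injEq]
  refine ⟨by linarith, ?_⟩
  have : 2 * κ ≠ 0 := by positivity
  exact (mul_eq_zero.1 h2.symm).resolve_left this

/-- The squares of the lengths of the expanding and the contracting component differ by `4κ` times
the radial velocity, and their product depends on the first integrals only. -/
theorem sq_norm_expanding (κ : ℝ) (x v : ℂ) :
    ‖expanding κ x v‖ ^ 2 * (‖expanding κ x v‖ ^ 2 - 4 * κ * rad x v) =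
      4 * nrg κ x v ^ 2 + 4 * κ ^ 2 * ang x v ^ 2 := by
  simp only [sq_norm_eq, expanding, rad, nrg, ang]
  simp
  ring

/-- Inside a disk, a state with given energy and angular momentum is determined by its radial
velocity and the direction of its expanding component. -/
theorem state_ext (hκ : 0 < κ) {x' v' : ℂ} (hne : (nrg κ x v, ang x v) ≠ (0, 0))
    (hn : nrg κ x v = nrg κ x' v') (ha : ang x v = ang x' v') (hr : rad x v = rad x' v')
    (hd : dir (expanding κ x v) = dir (expanding κ x' v')) : x = x' ∧ v = v' := by
  have hp := expanding_ne_zero hκ hne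
  have hp' : expanding κ x' v' ≠ 0 := expanding_ne_zero hκ (hn ▸ ha ▸ hne)
  have e1 := sq_norm_expanding κ x v
  have e2 := sq_norm_expanding κ x' v'
  rw [← hn, ← ha, ← hr, ← e1] at e2
  have hP : 0 < ‖expanding κ x v‖ ^ 2 := by positivity
  have hP' : 0 < ‖expanding κ x' v'‖ ^ 2 := by positivity
  have hc : 0 < 4 * nrg κ x v ^ 2 + 4 * κ ^ 2 * ang x v ^ 2 := by
    by_contra hcon
    have hh : 4 * nrg κ x v ^ 2 = 0 ∧ 4 * κ ^ 2 * ang x v ^ 2 = 0 := by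
      have := sq_nonneg (nrg κ x v)
      have : 0 ≤ 4 * κ ^ 2 * ang x v ^ 2 := by positivity
      constructor <;> linarith
    apply hne
    simp_all [hκ.ne']
  have hnorm : ‖expanding κ x v‖ = ‖expanding κ x' v'‖ := by
    have hfac : (‖expanding κ x v‖ ^ 2 - ‖expanding κ x' v'‖ ^ 2) *
        (‖expanding κ x v‖ ^ 2 + ‖expanding κ x' v'‖ ^ 2 - 4 * κ * rad x v) = 0 := by
      linear_combination -e2
    have hpos : 0 < ‖expanding κ x v‖ ^ 2 - 4 * κ * rad x v := by
      rw [← e1] at hc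
      exact (mul_pos_iff_of_pos_left hP).1 hc
    have := (mul_eq_zero.1 hfac).resolve_right (by linarith)
    exact (sq_eq_sq₀ (norm_nonneg _) (norm_nonneg _)).1 (by linarith)
  have hpe : expanding κ x v = expanding κ x' v' := by
    rw [← norm_mul_dir (expanding κ x v), ← norm_mul_dir (expanding κ x' v'), hnorm, hd]
  have hq : v - κ * x = v' - κ * x' := by
    have c1 := conj_expanding_mul κ x v
    have c2 := conj_expanding_mul κ x' v'
    rw [← hn, ← ha, ← c1, ← hpe] at c2
    exact (mul_left_cancel₀ (by simpa using hp) c2).symm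
  have hκ' : (κ : ℂ) ≠ 0 := by exact_mod_cast hκ.ne'
  unfold expanding at hpe
  constructor
  · have : (2 * κ : ℂ) * x = 2 * κ * x' := by linear_combination hpe - hq
    exact mul_left_cancel₀ (by simpa using hκ') this
  · have : (2 : ℂ) * v = 2 * v' := by linear_combination hpe + hq
    exact mul_left_cancel₀ two_ne_zero this

/-- Every radial velocity up to the impact speed and every direction of the expanding component
occur inside the disk. -/
theorem exists_state (hκ : 0 < κ) (hne : (h, f) ≠ (0, 0)) (hf : 0 ≤ 2 * h + κ ^ 2 - f ^ 2) {a : ℝ}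
    (ha : a ^ 2 ≤ impact κ h f ^ 2) (d : Circle) :
    ∃ x v : ℂ, ‖x‖ ≤ 1 ∧ nrg κ x v = h ∧ ang x v = f ∧ rad x v = a ∧
      dir (expanding κ x v) = d := by
  have hc : 0 < 4 * h ^ 2 + 4 * κ ^ 2 * f ^ 2 := by
    by_contra hcon
    have hh : 4 * h ^ 2 = 0 ∧ 4 * κ ^ 2 * f ^ 2 = 0 := by
      have := sq_nonneg h
      have : 0 ≤ 4 * κ ^ 2 * f ^ 2 := by positivity
      constructor <;> linarith
    apply hne
    simp_all [hκ.ne']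
  -- the squared length of the expanding component is the positive root of a quadratic equation
  obtain ⟨P, hP, hPq⟩ : ∃ P : ℝ, 0 < P ∧
      P * (P - 4 * κ * a) = 4 * h ^ 2 + 4 * κ ^ 2 * f ^ 2 := by
    set s := √((2 * κ * a) ^ 2 + (4 * h ^ 2 + 4 * κ ^ 2 * f ^ 2))
    have hs : s ^ 2 = (2 * κ * a) ^ 2 + (4 * h ^ 2 + 4 * κ ^ 2 * f ^ 2) :=
      Real.sq_sqrt (by positivity)
    have hs0 : |2 * κ * a| < s := Real.lt_sqrt_of_sq_lt (by rw [sq_abs]; linarith)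
    refine ⟨2 * κ * a + s, by linarith [neg_abs_le (2 * κ * a)], by nlinarith⟩
  set r := √P
  have hr : r ^ 2 = P := Real.sq_sqrt hP.le
  have hr0 : 0 < r := Real.sqrt_pos.2 hP
  have hd : (d : ℂ).re ^ 2 + (d : ℂ).im ^ 2 = 1 := by
    rw [← sq_norm_eq, Circle.norm_coe]; norm_num
  set c : ℂ := ⟨2 * h, 2 * κ * f⟩
  set p : ℂ := r * d
  set q : ℂ := (r⁻¹ : ℝ) * (c * d)
  have hκ' : (κ : ℂ) ≠ 0 := by exact_mod_cast hκ.ne'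
  set x : ℂ := ((2 * κ)⁻¹ : ℝ) * (p - q)
  set v : ℂ := (2⁻¹ : ℝ) * (p + q)
  have hp : expanding κ x v = p := by
    simp only [expanding, x, v]; push_cast; field_simp; ring
  have hq : v - κ * x = q := by
    simp only [x, v]; push_cast; field_simp; ring
  have hpq : starRingEnd ℂ p * q = c := by
    have hd' : starRingEnd ℂ (d : ℂ) * d = 1 := by
      rw [Complex.conj_mul', Circle.norm_coe]; norm_num
    have hr' : (r : ℂ) ≠ 0 := by exact_mod_cast hr0.ne'
    simp only [p, q, map_mul, Complex.conj_ofReal]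
    push_cast
    field_simp
    linear_combination c * hd'
  have hcc := conj_expanding_mul κ x v
  rw [hp, hq, hpq] at hcc
  have hE : nrg κ x v = h := by
    have := congrArg Complex.re hcc
    simp only [c] at this
    linarith
  have hF : ang x v = f := by
    have := congrArg Complex.im hcc
    simp only [c] at this
    exact (mul_left_cancel₀ (by positivity : 2 * κ ≠ 0) this).symm
  have hR : rad x v = a := by
    have e := sq_norm_expanding κ x v
    rw [hE, hF, ← hPq, hp] at e
    have : ‖p‖ ^ 2 = P := by
      simp only [p, norm_mul, Circle.norm_coe, mul_one, Complex.norm_real, Real.norm_eq_abs, sq_abs]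
      exact hr
    rw [this] at e
    have := mul_left_cancel₀ hP.ne' e
    exact mul_left_cancel₀ (by positivity : 4 * κ ≠ 0) (by linarith)
  refine ⟨x, v, ?_, hE, hF, hR, ?_⟩
  · have e := rad_sq_add κ x v
    rw [hE, hF, hR] at e
    rw [impact, Real.sq_sqrt hf] at ha
    have : 0 ≤ (1 - ‖x‖ ^ 2) * (‖v‖ ^ 2 + κ ^ 2) := by linarith
    have := (mul_nonneg_iff_of_pos_right (by positivity)).1 this
    nlinarith [norm_nonneg x]
  · rw [hp]
    exact dir_eq_of_mul hr0 rfl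

theorem sub_impact_ne_zero (hne : (h, f) ≠ (0, 0)) (hf : 0 ≤ 2 * h + κ ^ 2 - f ^ 2) :
    (⟨κ - impact κ h f, f⟩ : ℂ) ≠ 0 := fun h0 => by
  have h1 := congrArg Complex.re h0
  have h2 := congrArg Complex.im h0
  simp only [Complex.zero_re, Complex.zero_im] at h1 h2
  have h3 : impact κ h f ^ 2 = 2 * h + κ ^ 2 - f ^ 2 := Real.sq_sqrt hf
  rw [← sub_eq_zero.1 h1, h2] at h3
  apply hne
  rw [Prod.mk.injEq]
  exact ⟨by linarith, h2⟩

theorem norm_reflect (hx : ‖x‖ = 1) : ‖reflect x v‖ = ‖v‖ :=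
  (sq_eq_sq₀ (norm_nonneg _) (norm_nonneg _)).1 (normSq_reflect hx v)

theorem nrg_reflect (hx : ‖x‖ = 1) : nrg κ x (reflect x v) = nrg κ x v := by
  rw [nrg, nrg, norm_reflect hx]

theorem ang_reflect : ang x (reflect x v) = ang x v := by
  simp [ang, reflect]; ring

theorem rad_reflect (hx : ‖x‖ = 1) : rad x (reflect x v) = -rad x v := by
  have h1 : x.re ^ 2 + x.im ^ 2 = 1 := by rw [← sq_norm_eq, hx]; norm_num
  simp only [rad, reflect, Complex.sub_re, Complex.sub_im, Complex.real_smul, Complex.mul_re,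
    Complex.mul_im, Complex.ofReal_re, Complex.ofReal_im, zero_mul, sub_zero, add_zero]
  linear_combination (-2 * (x.re * v.re + x.im * v.im)) * h1

theorem state_ext_boundary {v' : ℂ} (hx : ‖x‖ = 1) (hr : rad x v = rad x v')
    (ha : ang x v = ang x v') : v = v' := by
  rw [eq_mul_of_norm_eq_one (v := v) hx, eq_mul_of_norm_eq_one (v := v') hx, hr, ha]

end

/-! ### Cylinder coordinates on the sheets -/

section PrePhase

variable {n : ℕ} {κ : ℝ}

/-- The radial velocity of a state on one of the sheets. -/
def pRad (a : PrePhase n) : ℝ := rad a.2.1 a.2.2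

/-- The angular momentum of a state on one of the sheets. -/
def pAng (a : PrePhase n) : ℝ := ang a.2.1 a.2.2

/-- The energy of a state on one of the sheets. -/
def pNrg (κ : ℝ) (a : PrePhase n) : ℝ := nrg κ a.2.1 a.2.2

/-- The impact speed of a state on one of the sheets. -/
def pImp (κ : ℝ) (a : PrePhase n) : ℝ := impact κ (pNrg κ a) (pAng a)

/-- The expanding component of a state on one of the sheets. -/
def pExp (κ : ℝ) (a : PrePhase n) : ℂ := expanding κ a.2.1 a.2.2

/-- The progress of the ball on its sheet: `0` when it enters, `1` when it leaves. (At tangent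
states, where the impact speed vanishes, the value is `1 / 2`.) -/
def frac (κ : ℝ) (a : PrePhase n) : ℝ := (1 + pRad a / pImp κ a) / 2

/-- The progress of the ball through all `n` sheets, as a point of the unit circle. -/
def phase (κ : ℝ) (a : PrePhase n) : Circle :=
  Circle.exp (2 * Real.pi * (((a.1 : ℕ) : ℝ) + frac κ a) / n)

/-- The argument of `κ + s + i f` where `s` is the impact speed: at a collision, the direction of
the expanding component of the outgoing state relative to the position. -/
def exitArg (κ h f : ℝ) : ℝ := Complex.arg ⟨κ + impact κ h f, f⟩

/-- The rotation angle of a state: the direction of the expanding component, turned back by an angle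
that runs from `A` to `exitArg` while the ball crosses the sheet. If `A` is an argument of
`κ - s + i f`, then this is the position of the ball whenever it is on the boundary circle, so that
it is unchanged by collisions. -/
def gauge (κ A : ℝ) (a : PrePhase n) : Circle :=
  dir (pExp κ a) *
    (Circle.exp ((1 - frac κ a) * A + frac κ a * exitArg κ (pNrg κ a) (pAng a)))⁻¹

/-- `A` is an argument of `κ - s + i f`, where `s` is the impact speed. -/
def IsEntryArg (κ h f A : ℝ) : Prop := Circle.exp A = dir ⟨κ - impact κ h f, f⟩

theorem norm_pos_le (a : PrePhase n) : ‖(a.2.1 : ℂ)‖ ≤ 1 := mem_closedBall_zero_iff.1 a.2.1.2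

theorem pImp_nonneg (a : PrePhase n) : 0 ≤ pImp κ a := impact_nonneg

theorem abs_pRad_le (a : PrePhase n) : |pRad a| ≤ pImp κ a := abs_rad_le_impact (norm_pos_le a)

theorem pRad_eq {a : PrePhase n} (h0 : pImp κ a ≠ 0) : pRad a = (2 * frac κ a - 1) * pImp κ a := by
  rw [frac]; field_simp; ring

theorem frac_mem (a : PrePhase n) : 0 ≤ frac κ a ∧ frac κ a ≤ 1 := by
  have h2 : |pRad a / pImp κ a| ≤ 1 := by
    rw [abs_div, abs_of_nonneg (pImp_nonneg a)]
    exact div_le_one_of_le₀ (abs_pRad_le a) (pImp_nonneg a)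
  have := abs_le.1 h2
  constructor <;> unfold frac <;> linarith

theorem norm_eq_one_of_sq (hκ : 0 < κ) {a : PrePhase n} (h : pRad a ^ 2 = pImp κ a ^ 2) :
    ‖(a.2.1 : ℂ)‖ = 1 := norm_eq_one_of_rad_sq hκ (norm_pos_le a) h

theorem norm_eq_one_of_frac (hκ : 0 < κ) {a : PrePhase n} (h0 : pImp κ a ≠ 0)
    (h : frac κ a = 0 ∨ frac κ a = 1) : ‖(a.2.1 : ℂ)‖ = 1 := by
  refine norm_eq_one_of_sq hκ ?_
  rw [pRad_eq h0]
  rcases h with h | h <;> rw [h] <;> ring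

theorem pRad_eq_zero {a : PrePhase n} (h : pImp κ a = 0) : pRad a = 0 := by
  have := abs_pRad_le (κ := κ) a
  rw [h] at this
  exact abs_nonpos_iff.1 this

theorem norm_eq_one_of_pImp (hκ : 0 < κ) {a : PrePhase n} (h : pImp κ a = 0) :
    ‖(a.2.1 : ℂ)‖ = 1 :=
  norm_eq_one_of_sq hκ (by rw [h, pRad_eq_zero h])

/-- On the boundary circle the rotation angle is the position of the ball. -/
theorem gauge_of_norm_eq_one (hκ : 0 < κ) {A : ℝ} {a : PrePhase n} (hx : ‖(a.2.1 : ℂ)‖ = 1)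
    (hne : (pNrg κ a, pAng a) ≠ (0, 0)) (hA : IsEntryArg κ (pNrg κ a) (pAng a) A)
    (h0 : pImp κ a = 0 → A = exitArg κ (pNrg κ a) (pAng a)) :
    gauge κ A a = dir (a.2.1 : ℂ) := by
  have hx0 : (a.2.1 : ℂ) ≠ 0 := norm_pos_iff.1 (by rw [hx]; exact one_pos)
  have hp : pExp κ a = a.2.1 * ⟨κ + pRad a, pAng a⟩ := expanding_of_norm_eq_one hx
  have hdisc := discr_nonneg (κ := κ) (v := a.2.2) (norm_pos_le a)
  have hi : pImp κ a = |pRad a| := impact_eq_abs_rad hx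
  have key : dir ⟨κ + pRad a, pAng a⟩ =
      Circle.exp ((1 - frac κ a) * A + frac κ a * exitArg κ (pNrg κ a) (pAng a)) := by
    by_cases hz : pImp κ a = 0
    · rw [h0 hz, pRad_eq_zero hz, ← hz, pImp, ← exp_arg_eq_dir, exitArg]
      congr 1
      ring
    · rcases abs_choice (pRad a) with hc | hc <;> rw [hc] at hi
      · have hf : frac κ a = 1 := by rw [frac, hi, div_self (hi ▸ hz)]; norm_num
        rw [hf, ← hi, pImp, ← exp_arg_eq_dir, exitArg]
        congr 1
        ring
      · have hr : pRad a = -pImp κ a := by linarith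
        have hf : frac κ a = 0 := by rw [frac, hr, neg_div, div_self hz]; norm_num
        rw [hf, hr, ← sub_eq_add_neg]
        unfold IsEntryArg at hA
        rw [pImp, ← hA]
        congr 1
        ring
  have hne' : (⟨κ + pRad a, pAng a⟩ : ℂ) ≠ 0 := by
    intro h
    rw [h, mul_zero] at hp
    exact expanding_ne_zero hκ hne hp
  rw [gauge, hp, dir_mul hx0 hne', key, mul_inv_cancel_right]

/-- Changing the entry angle by a full turn multiplies the rotation angle by the `n`-th power of the
progress, because this power makes one turn on each sheet. -/
theorem gauge_add_two_pi (hn : 0 < n) {A : ℝ} (a : PrePhase n) :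
    gauge κ (A + 2 * Real.pi) a = gauge κ A a * phase κ a ^ n := by
  have h1 : phase κ a ^ n = Circle.exp (2 * Real.pi * frac κ a) := by
    rw [phase, ← Circle.exp_natCast_mul, mul_div_cancel₀ _ (by positivity), mul_add, Circle.exp_add]
    have := Circle.exp_two_pi_mul_int (a.1 : ℕ)
    push_cast at this
    rw [this, one_mul]
  rw [h1, gauge, gauge, mul_assoc, ← Circle.exp_neg, ← Circle.exp_neg, ← Circle.exp_add,
    ← Circle.exp_sub_two_pi (-_ + _)]
  congr 2
  ring

/-! ### Invariance under collisions -/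

theorem momentum_mk (a : PrePhase n) :
    momentum n (-κ ^ 2) (Quot.mk _ a) = (pNrg κ a, pAng a) := rfl

theorem finRotate_val (i : Fin n) :
    ((finRotate n i : ℕ) = i + 1 ∧ (i : ℕ) + 1 < n) ∨
      ((finRotate n i : ℕ) = 0 ∧ (i : ℕ) + 1 = n) := by
  rcases n with _ | m
  · exact i.elim0
  · rcases lt_or_ge (i : ℕ) m with hi | hi
    · left
      have h := finRotate_of_lt hi
      exact ⟨by simpa using congrArg Fin.val h, by omega⟩
    · right
      have : i = Fin.last m := Fin.ext (by simp; omega)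
      subst this
      exact ⟨by rw [finRotate_last]; rfl, by simp⟩

theorem Glue.pNrg_eq {a b : PrePhase n} (hg : Glue (finRotate n) a b) : pNrg κ b = pNrg κ a := by
  obtain ⟨hx, -, rfl⟩ := hg
  exact nrg_reflect hx

theorem Glue.pAng_eq {a b : PrePhase n} (hg : Glue (finRotate n) a b) : pAng b = pAng a := by
  obtain ⟨hx, -, rfl⟩ := hg
  exact ang_reflect

theorem Glue.pImp_eq {a b : PrePhase n} (hg : Glue (finRotate n) a b) : pImp κ b = pImp κ a := by
  rw [pImp, pImp, hg.pNrg_eq, hg.pAng_eq]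

theorem Glue.frac_eq {a b : PrePhase n} (hg : Glue (finRotate n) a b) (h0 : pImp κ a ≠ 0) :
    frac κ a = 1 ∧ frac κ b = 0 := by
  have hi := hg.pImp_eq (κ := κ)
  obtain ⟨hx, hr, rfl⟩ := hg
  have h1 : pImp κ a = pRad a := by
    rw [← abs_of_nonneg (show 0 ≤ pRad a from hr)]; exact impact_eq_abs_rad hx
  have h2 : pRad (finRotate n a.1, a.2.1, reflect a.2.1 a.2.2) = -pRad a := rad_reflect hx
  rw [frac, frac, hi, h2, neg_div, h1, div_self (h1 ▸ h0)]
  norm_num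

theorem Glue.phase_eq {a b : PrePhase n} (hg : Glue (finRotate n) a b) (h0 : pImp κ a ≠ 0) :
    phase κ a = phase κ b := by
  obtain ⟨h1, h2⟩ := hg.frac_eq h0
  have hb : b.1 = finRotate n a.1 := by obtain ⟨-, -, rfl⟩ := hg; rfl
  rw [phase, phase, h1, h2, hb]
  rcases finRotate_val a.1 with ⟨h, -⟩ | ⟨h, h'⟩
  · rw [h]; push_cast; rw [add_zero]
  · have hn : (n : ℝ) ≠ 0 := by
      have : 0 < n := by omega
      positivity
    have : ((a.1 : ℕ) : ℝ) + 1 = n := by exact_mod_cast h'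
    rw [h, this, mul_div_cancel_right₀ _ hn]
    simp

theorem Glue.gauge_eq (hκ : 0 < κ) {A : ℝ} {a b : PrePhase n} (hg : Glue (finRotate n) a b)
    (hne : (pNrg κ a, pAng a) ≠ (0, 0)) (hA : IsEntryArg κ (pNrg κ a) (pAng a) A)
    (h0 : pImp κ a = 0 → A = exitArg κ (pNrg κ a) (pAng a)) : gauge κ A a = gauge κ A b := by
  have hxb : (b.2.1 : ℂ) = a.2.1 := by obtain ⟨-, -, rfl⟩ := hg; rfl
  rw [gauge_of_norm_eq_one hκ hg.1 hne hA h0, gauge_of_norm_eq_one hκ (hxb ▸ hg.1), hxb]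
  · rwa [hg.pNrg_eq, hg.pAng_eq]
  · rwa [hg.pNrg_eq, hg.pAng_eq]
  · rwa [hg.pNrg_eq, hg.pAng_eq, hg.pImp_eq]

/-- A function on the sheets that is unchanged by collisions of states in an invariant set takes
equal values on states of this set that are identified in phase space. -/
theorem eq_of_mk_eq {T : Type*} {Q : PrePhase n → T} {P : PrePhase n → Prop}
    (hP : ∀ a b, Glue (finRotate n) a b → (P a ↔ P b))
    (hQ : ∀ a b, Glue (finRotate n) a b → P a → Q a = Q b) {a b : PrePhase n}
    (h : (Quot.mk _ a : Phase n) = Quot.mk _ b) (ha : P a) : Q a = Q b := by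
  have key : (P a ↔ P b) ∧ (P a → Q a = Q b) := by
    have hh := Quot.eqvGen_exact h
    clear h ha
    induction hh with
    | rel a b hg => exact ⟨hP a b hg, hQ a b hg⟩
    | refl a => exact ⟨Iff.rfl, fun _ => rfl⟩
    | symm a b _ ih => exact ⟨ih.1.symm, fun h => (ih.2 (ih.1.2 h)).symm⟩
    | trans a b c _ _ ih1 ih2 =>
      exact ⟨ih1.1.trans ih2.1, fun h => (ih1.2 h).trans (ih2.2 (ih1.1.1 h))⟩
  exact key.2 ha

/-! ### Points of the fibres -/

/-- Equal progress means equal sheet and radial velocity, except that leaving a sheet agrees with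
entering the next one. -/
theorem eq_or_of_phase_eq {a b : PrePhase n} (h : phase κ a = phase κ b) :
    (a.1 = b.1 ∧ frac κ a = frac κ b) ∨
      (b.1 = finRotate n a.1 ∧ frac κ a = 1 ∧ frac κ b = 0) ∨
      (a.1 = finRotate n b.1 ∧ frac κ b = 1 ∧ frac κ a = 0) := by
  have hn : 0 < n := a.1.pos
  have hn' : (0 : ℝ) < n := by exact_mod_cast hn
  obtain ⟨m, hm⟩ := Circle.exp_eq_exp.1 h
  have e : ((a.1 : ℕ) : ℝ) + frac κ a = (b.1 : ℕ) + frac κ b + m * n := by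
    have hpi := Real.pi_pos
    field_simp at hm
    linarith
  obtain ⟨a0, a1⟩ := frac_mem (κ := κ) a
  obtain ⟨b0, b1⟩ := frac_mem (κ := κ) b
  have ha := a.1.2
  have hb := b.1.2
  set i : ℕ := (a.1 : ℕ) with hi
  set j : ℕ := (b.1 : ℕ) with hj
  -- the difference of the fractional parts is an integer, hence `-1`, `0` or `1`
  obtain ⟨d, hd⟩ : ∃ d : ℤ, d = (j : ℤ) + m * n - i := ⟨_, rfl⟩
  have hd' : frac κ a - frac κ b = d := by rw [hd]; push_cast; linarith
  have d1 : d ≤ 1 := by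
    have : (d : ℝ) ≤ 1 := by linarith
    exact_mod_cast this
  have d2 : -1 ≤ d := by
    have : (-1 : ℝ) ≤ d := by linarith
    exact_mod_cast this
  have hmn : ∀ t : ℤ, t = m * n → (t < n → t ≤ 0) ∧ (-n < t → 0 ≤ t) ∧
      (t < 2 * n → t ≤ n) ∧ (-(2 * n) < t → -n ≤ t) := by
    intro t ht
    have hnz : (0 : ℤ) < n := by exact_mod_cast hn
    refine ⟨fun h => ?_, fun h => ?_, fun h => ?_, fun h => ?_⟩
    · have : m < 1 := by nlinarith
      nlinarith
    · have : -1 < m := by nlinarith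
      nlinarith
    · have : m < 2 := by nlinarith
      nlinarith
    · have : -2 < m := by nlinarith
      nlinarith
  obtain ⟨m1, m2, m3, m4⟩ := hmn (m * n) rfl
  have hcase : d = -1 ∨ d = 0 ∨ d = 1 := by omega
  generalize m * (n : ℤ) = t at *
  have hfr : ∀ p q : Fin n, (p : ℕ) + 1 = q ∨ ((p : ℕ) + 1 = n ∧ (q : ℕ) = 0) →
      q = finRotate n p := by
    intro p q hpq
    apply Fin.ext
    rcases finRotate_val p with ⟨h1, h2⟩ | ⟨h1, h2⟩ <;> rw [h1] <;> have := q.2 <;> omega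
  rcases hcase with rfl | rfl | rfl
  · right; right
    refine ⟨hfr _ _ ?_, ?_, ?_⟩
    · rw [← hi, ← hj]; omega
    · push_cast at hd'; linarith
    · push_cast at hd'; linarith
  · left
    refine ⟨Fin.ext ?_, ?_⟩
    · rw [← hi, ← hj]; omega
    · push_cast at hd'; linarith
  · right; left
    refine ⟨hfr _ _ ?_, ?_, ?_⟩
    · rw [← hi, ← hj]; omega
    · push_cast at hd'; linarith
    · push_cast at hd'; linarith

theorem glue_of_frac (hκ : 0 < κ) {a b : PrePhase n} (h0 : pImp κ a ≠ 0)
    (hi : b.1 = finRotate n a.1) (ha : frac κ a = 1) (hb : frac κ b = 0)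
    (hn : pNrg κ a = pNrg κ b) (hf : pAng a = pAng b) (hx : a.2.1 = b.2.1) :
    Glue (finRotate n) a b := by
  have hxa := norm_eq_one_of_frac hκ h0 (Or.inr ha)
  have himp : pImp κ a = pImp κ b := by rw [pImp, pImp, hn, hf]
  have ra : pRad a = pImp κ a := by rw [pRad_eq h0, ha]; ring
  have rb : pRad b = -pImp κ a := by rw [pRad_eq (himp ▸ h0), hb, himp]; ring
  refine ⟨hxa, ?_, ?_⟩
  · change 0 ≤ pRad a
    rw [ra]; exact pImp_nonneg a
  · have hv : b.2.2 = reflect a.2.1 a.2.2 := by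
      refine state_ext_boundary hxa ?_ ?_
      · rw [rad_reflect hxa, show rad a.2.1 b.2.2 = pRad b by rw [pRad, hx], rb, ← ra, pRad]
      · rw [ang_reflect, show ang a.2.1 b.2.2 = pAng b by rw [pAng, hx], ← hf, pAng]
    rw [← hv, ← hi, hx]

/-- At a tangent state all sheets are identified. -/
theorem mk_eq_of_tangent {x : Disk} {v : ℂ} (hx : ‖(x : ℂ)‖ = 1) (hr : rad x v = 0) (i j : Fin n) :
    (Quot.mk _ (i, x, v) : Phase n) = Quot.mk _ (j, x, v) := by
  have step : ∀ i : Fin n, (Quot.mk _ (i, x, v) : Phase n) = Quot.mk _ (finRotate n i, x, v) := by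
    intro i
    refine Quot.sound ⟨hx, hr.ge, ?_⟩
    have : reflect x v = v := by
      have : x.1.re * v.re + x.1.im * v.im = 0 := hr
      rw [reflect, this]
      simp
    rw [this]
  have base : ∀ m : ℕ, ∀ h : m < n, (Quot.mk _ (⟨m, h⟩, x, v) : Phase n) =
      Quot.mk _ (⟨0, by omega⟩, x, v) := by
    intro m
    induction m with
    | zero => intro h; rfl
    | succ m ih =>
      intro h
      rw [← ih (by omega), step ⟨m, by omega⟩]
      congr 2
      apply Fin.ext
      rcases finRotate_val (⟨m, by omega⟩ : Fin n) with ⟨h1, -⟩ | ⟨-, h2⟩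
      · exact h1.symm
      · simp at h2; omega
  rw [base i i.2, base j j.2]

theorem mk_eq_of_pImp_eq_zero (hκ : 0 < κ) {a b : PrePhase n} (h0 : pImp κ a = 0)
    (h0' : pImp κ b = 0) (hf : pAng a = pAng b) (hx : a.2.1 = b.2.1) :
    (Quot.mk _ a : Phase n) = Quot.mk _ b := by
  have hxa := norm_eq_one_of_pImp hκ h0
  have ra := pRad_eq_zero h0
  have hv : a.2.2 = b.2.2 := by
    refine state_ext_boundary hxa ?_ ?_
    · rw [hx]
      exact (hx ▸ ra : rad b.2.1 a.2.2 = 0).trans (pRad_eq_zero h0').symm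
    · rw [show ang a.2.1 a.2.2 = ang b.2.1 b.2.2 from hf, hx]
  obtain ⟨i, x, v⟩ := a
  obtain ⟨j, x', v'⟩ := b
  obtain rfl : x = x' := hx
  obtain rfl : v = v' := hv
  exact mk_eq_of_tangent hxa ra i j

theorem dir_eq_position {x y : Disk} (hx : ‖(x : ℂ)‖ = 1) (hy : ‖(y : ℂ)‖ = 1)
    (h : dir (x : ℂ) = dir (y : ℂ)) : x = y := by
  apply Subtype.ext
  rw [← norm_mul_dir x, ← norm_mul_dir y, hx, hy, h]

/-- Points of a regular fibre are determined by progress and rotation angle. -/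
theorem mk_eq_of_gauge_eq (hκ : 0 < κ) {A : ℝ} {a b : PrePhase n} (h0 : pImp κ a ≠ 0)
    (hne : (pNrg κ a, pAng a) ≠ (0, 0)) (hn : pNrg κ a = pNrg κ b) (hf : pAng a = pAng b)
    (hA : IsEntryArg κ (pNrg κ a) (pAng a) A) (hp : phase κ a = phase κ b)
    (hg : gauge κ A a = gauge κ A b) : (Quot.mk _ a : Phase n) = Quot.mk _ b := by
  have himp : pImp κ a = pImp κ b := by rw [pImp, pImp, hn, hf]
  have h0' : pImp κ b ≠ 0 := himp ▸ h0
  have bd : ‖(a.2.1 : ℂ)‖ = 1 → ‖(b.2.1 : ℂ)‖ = 1 → a.2.1 = b.2.1 := by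
    intro ha hb
    refine dir_eq_position ha hb ?_
    rw [← gauge_of_norm_eq_one hκ ha hne hA (fun h => absurd h h0), hg,
      gauge_of_norm_eq_one hκ hb (hn ▸ hf ▸ hne) (hn ▸ hf ▸ hA) (fun h => absurd h h0')]
  rcases eq_or_of_phase_eq hp with ⟨hi, hu⟩ | ⟨hi, h1, h2⟩ | ⟨hi, h1, h2⟩
  · rw [gauge, gauge, hu, hn, hf] at hg
    have hd := mul_right_cancel hg
    obtain ⟨hx, hv⟩ := state_ext hκ hne hn hf
      (show pRad a = pRad b by rw [pRad_eq h0, pRad_eq h0', hu, himp]) hd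
    congr 1
    exact Prod.ext hi (Prod.ext (Subtype.ext hx) hv)
  · have hx := bd (norm_eq_one_of_frac hκ h0 (Or.inr h1)) (norm_eq_one_of_frac hκ h0' (Or.inl h2))
    exact Quot.sound (glue_of_frac hκ h0 hi h1 h2 hn hf hx)
  · have hx := bd (norm_eq_one_of_frac hκ h0 (Or.inl h2)) (norm_eq_one_of_frac hκ h0' (Or.inr h1))
    exact (Quot.sound (glue_of_frac hκ h0' hi h1 h2 hn.symm hf.symm hx.symm)).symm

/-- On a regular fibre, progress and rotation angle are coordinates. -/
theorem mk_eq_iff (hκ : 0 < κ) {h f A : ℝ} (h0 : impact κ h f ≠ 0) (hne : (h, f) ≠ (0, 0))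
    (hA : IsEntryArg κ h f A) {a b : PrePhase n} (ha : pNrg κ a = h ∧ pAng a = f)
    (hb : pNrg κ b = h ∧ pAng b = f) :
    (Quot.mk _ a : Phase n) = Quot.mk _ b ↔
      gauge κ A a = gauge κ A b ∧ phase κ a = phase κ b := by
  constructor
  · intro h1
    have := eq_of_mk_eq (Q := fun a => (gauge κ A a, phase κ a))
      (P := fun a => pNrg κ a = h ∧ pAng a = f) (fun a b hg => ?_) (fun a b hg hP => ?_) h1 ha
    · exact Prod.mk.injEq _ _ _ _ ▸ this
    · rw [hg.pNrg_eq (κ := κ), hg.pAng_eq]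
    · obtain ⟨rfl, rfl⟩ := hP
      exact Prod.ext (hg.gauge_eq hκ hne hA fun hz => absurd hz h0) (hg.phase_eq h0)
  · rintro ⟨h1, h2⟩
    obtain ⟨rfl, rfl⟩ := ha
    exact mk_eq_of_gauge_eq hκ h0 hne hb.1.symm hb.2.symm hA h2 h1

theorem exists_phase (hn : 0 < n) (y : Circle) :
    ∃ (i : Fin n) (u : ℝ), 0 ≤ u ∧ u ≤ 1 ∧
      Circle.exp (2 * Real.pi * (((i : ℕ) : ℝ) + u) / n) = y := by
  have hn' : (0 : ℝ) < n := by exact_mod_cast hn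
  have hpi := Real.pi_pos
  obtain ⟨t, ⟨ht0, ht1⟩, rfl⟩ : ∃ t ∈ Ico (0 : ℝ) (2 * Real.pi), Circle.exp t = y := by
    refine ⟨toIcoMod Real.two_pi_pos 0 (y : ℂ).arg, ?_, ?_⟩
    · simpa using toIcoMod_mem_Ico Real.two_pi_pos 0 (y : ℂ).arg
    · conv_rhs => rw [← Circle.exp_arg y]
      refine Circle.exp_eq_exp.2 ⟨-toIcoDiv Real.two_pi_pos 0 (y : ℂ).arg, ?_⟩
      have := self_sub_toIcoDiv_zsmul Real.two_pi_pos 0 (y : ℂ).arg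
      rw [← this, zsmul_eq_mul]
      push_cast
      ring
  set s := n * t / (2 * Real.pi)
  have hs0 : 0 ≤ s := by positivity
  have hs1 : s < n := by
    rw [div_lt_iff₀ (by positivity)]
    exact mul_lt_mul_of_pos_left ht1 hn'
  refine ⟨⟨⌊s⌋₊, (Nat.floor_lt hs0).2 hs1⟩, s - ⌊s⌋₊, ?_, ?_, ?_⟩
  · linarith [Nat.floor_le hs0]
  · linarith [Nat.lt_floor_add_one s]
  · congr 1
    simp only [add_sub_cancel, s]
    field_simp

/-- All pairs of progress and rotation angle occur on a regular fibre. -/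
theorem exists_of_gauge (hn : 0 < n) (hκ : 0 < κ) {h f : ℝ} (hne : (h, f) ≠ (0, 0))
    (hf : 0 < 2 * h + κ ^ 2 - f ^ 2) (A : ℝ) (θ y : Circle) :
    ∃ a : PrePhase n, pNrg κ a = h ∧ pAng a = f ∧ phase κ a = y ∧ gauge κ A a = θ := by
  obtain ⟨i, u, hu0, hu1, hy⟩ := exists_phase hn y
  have himp : 0 < impact κ h f := Real.sqrt_pos.2 hf
  obtain ⟨x, v, hx, h1, h2, h3, h4⟩ := exists_state hκ hne hf.le
    (a := (2 * u - 1) * impact κ h f) (by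
      rw [mul_pow]
      have : (2 * u - 1) ^ 2 ≤ 1 := by nlinarith
      nlinarith [sq_nonneg (impact κ h f)])
    (θ * Circle.exp ((1 - u) * A + u * exitArg κ h f))
  have hfr : frac κ ((i, ⟨x, mem_closedBall_zero_iff.2 hx⟩, v) : PrePhase n) = u := by
    simp only [frac, pRad, pImp, pNrg, pAng, h1, h2, h3]
    field_simp; ring
  refine ⟨(i, ⟨x, mem_closedBall_zero_iff.2 hx⟩, v), h1, h2, ?_, ?_⟩
  · rw [phase, hfr]; exact hy
  · rw [gauge, hfr]
    simp only [pExp, pNrg, pAng, h1, h2, h4]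
    rw [mul_inv_cancel_right]

/-- On the boundary of the momentum image, the ball runs along the boundary circle. -/
theorem exists_tangent (hn : 0 < n) {h f : ℝ} (hf : 2 * h + κ ^ 2 - f ^ 2 = 0) (x : Circle) :
    ∃ a : PrePhase n, pNrg κ a = h ∧ pAng a = f ∧ (a.2.1 : ℂ) = x ∧
      a.2.2 = (f : ℂ) * Complex.I * x := by
  have hx : (x : ℂ).re ^ 2 + (x : ℂ).im ^ 2 = 1 := by
    rw [← sq_norm_eq, Circle.norm_coe]; norm_num
  refine ⟨(⟨0, hn⟩, ⟨x, by simp [Circle.norm_coe]⟩, (f : ℂ) * Complex.I * x), ?_, ?_, rfl, rfl⟩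
  · simp only [pNrg, nrg, norm_mul, Circle.norm_coe, Complex.norm_I, Complex.norm_real,
      Real.norm_eq_abs, mul_one, sq_abs]
    linarith
  · simp only [pAng, ang]
    simp
    linear_combination f * hx

/-! ### Continuity and compactness -/

theorem continuous_pRad : Continuous (pRad : PrePhase n → ℝ) := by
  unfold pRad rad
  have h1 := Complex.continuous_re
  have h2 := Complex.continuous_im
  fun_prop

theorem continuous_pAng : Continuous (pAng : PrePhase n → ℝ) := by
  unfold pAng ang
  have h1 := Complex.continuous_re
  have h2 := Complex.continuous_im
  fun_prop

theorem continuous_pNrg : Continuous (pNrg κ : PrePhase n → ℝ) := by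
  unfold pNrg nrg
  fun_prop

theorem continuous_pImp : Continuous (pImp κ : PrePhase n → ℝ) := by
  have h1 := continuous_pNrg (n := n) (κ := κ)
  have h2 := continuous_pAng (n := n)
  unfold pImp impact
  fun_prop

theorem continuous_pExp : Continuous (pExp κ : PrePhase n → ℂ) := by
  unfold pExp expanding
  fun_prop

theorem continuousAt_frac {a : PrePhase n} (h : pImp κ a ≠ 0) : ContinuousAt (frac κ) a := by
  unfold frac
  have h1 := (continuous_pRad (n := n)).continuousAt (x := a)
  have h2 := (continuous_pImp (n := n) (κ := κ)).continuousAt (x := a)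
  have h3 := h1.div h2 h
  exact (continuousAt_const.add h3).div_const _

theorem continuousAt_phase {a : PrePhase n} (h : pImp κ a ≠ 0) : ContinuousAt (phase κ) a := by
  have h1 := continuousAt_frac h
  have h2 : Continuous fun a : PrePhase n => ((a.1 : ℕ) : ℝ) :=
    (continuous_of_discreteTopology (f := fun i : Fin n => ((i : ℕ) : ℝ))).comp continuous_fst
  unfold phase
  exact Circle.exp.continuous.continuousAt.comp
    ((continuousAt_const.mul (h2.continuousAt.add h1)).div_const _)

theorem continuous_exitArg_comp (hκ : 0 < κ) :
    Continuous fun a : PrePhase n => exitArg κ (pNrg κ a) (pAng a) := by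
  refine continuous_iff_continuousAt.2 fun a => ?_
  unfold exitArg
  have h1 : Continuous fun a : PrePhase n => (⟨κ + pImp κ a, pAng a⟩ : ℂ) :=
    Complex.equivRealProdCLM.symm.continuous.comp
      ((continuous_const.add continuous_pImp).prodMk continuous_pAng)
  refine ContinuousAt.comp (f := fun a : PrePhase n => (⟨κ + pImp κ a, pAng a⟩ : ℂ))
    (g := Complex.arg) (Complex.continuousAt_arg (Or.inl ?_)) h1.continuousAt
  have := pImp_nonneg (κ := κ) a
  change 0 < κ + pImp κ a
  linarith

/-- The rotation angle is continuous at a tangent state as well if the two angles that it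
interpolates agree there. -/
theorem continuousWithinAt_gauge (hκ : 0 < κ) {X : Type*} [TopologicalSpace X] {s : Set X} {x : X}
    {A : X → ℝ} {g : X → PrePhase n} (hA : ContinuousWithinAt A s x)
    (hg : ContinuousWithinAt g s x) (hne : (pNrg κ (g x), pAng (g x)) ≠ (0, 0))
    (h0 : pImp κ (g x) = 0 → A x = exitArg κ (pNrg κ (g x)) (pAng (g x))) :
    ContinuousWithinAt (fun y => gauge κ (A y) (g y)) s x := by
  have hE := ((continuous_exitArg_comp (n := n) hκ).continuousAt (x := g x)).comp_continuousWithinAt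
    hg
  have hD := hA.sub hE
  have hp : ContinuousWithinAt (fun y => dir (pExp κ (g y))) s x :=
    ContinuousAt.comp_continuousWithinAt (f := fun y => pExp κ (g y)) (g := dir)
      (continuousAt_dir (expanding_ne_zero hκ hne))
      (continuous_pExp.continuousAt.comp_continuousWithinAt hg)
  have hm : ContinuousWithinAt (fun y => (A y - exitArg κ (pNrg κ (g y)) (pAng (g y))) •
      (1 - frac κ (g y))) s x := by
    refine continuousWithinAt_smul_of_bounded 1 hD (fun y => ?_) (fun hd => ?_)
    · have := frac_mem (κ := κ) (g y)
      rw [Real.norm_eq_abs, abs_le]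
      constructor <;> linarith
    · have : pImp κ (g x) ≠ 0 := fun hz => hd (sub_eq_zero.2 (h0 hz))
      exact continuousWithinAt_const.sub ((continuousAt_frac this).comp_continuousWithinAt hg)
  have hfin : ContinuousWithinAt (fun y => dir (pExp κ (g y)) * (Circle.exp
      ((A y - exitArg κ (pNrg κ (g y)) (pAng (g y))) • (1 - frac κ (g y)) +
        exitArg κ (pNrg κ (g y)) (pAng (g y))))⁻¹) s x :=
    hp.mul (Circle.exp.continuous.continuousAt.comp_continuousWithinAt (hm.add hE)).inv
  refine hfin.congr_of_eventuallyEq (Filter.Eventually.of_forall fun y => ?_) ?_ <;>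
  · simp only [gauge, smul_eq_mul]
    congr 3
    ring

instance : CompactSpace Disk := isCompact_iff_compactSpace.1 (isCompact_closedBall _ _)

theorem isCompact_pNrg_le (κ h : ℝ) : IsCompact {a : PrePhase n | pNrg κ a ≤ h} := by
  have hc : IsCompact (univ ×ˢ univ ×ˢ Metric.closedBall (0 : ℂ) √(2 * h + κ ^ 2) :
      Set (PrePhase n)) := isCompact_univ.prod (isCompact_univ.prod (isCompact_closedBall _ _))
  refine hc.of_isClosed_subset (isClosed_le continuous_pNrg continuous_const) fun a ha => ?_
  refine ⟨mem_univ _, mem_univ _, ?_⟩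
  rw [mem_closedBall_zero_iff]
  apply Real.le_sqrt_of_sq_le
  have h1 : ‖a.2.2‖ ^ 2 / 2 + -κ ^ 2 / 2 * ‖(a.2.1 : ℂ)‖ ^ 2 ≤ h := ha
  have h2 : ‖(a.2.1 : ℂ)‖ ^ 2 ≤ 1 := pow_le_one₀ (norm_nonneg _) (norm_pos_le a)
  nlinarith [mul_le_mul_of_nonneg_left h2 (sq_nonneg κ)]

/-! ### Phase space is Hausdorff -/

/-- Functions of a state that are unchanged by collisions and separate the points of phase space. -/
def separating (κ : ℝ) (a : PrePhase n) : ℂ × ℂ × ℝ × ℝ × ℂ :=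
  (a.2.1, pImp κ a • (phase κ a : ℂ), pNrg κ a, pAng a, (1 - ‖(a.2.1 : ℂ)‖ ^ 2 : ℝ) • a.2.2)

theorem continuous_pImp_smul_phase :
    Continuous fun a : PrePhase n => pImp κ a • (phase κ a : ℂ) := by
  refine continuous_iff_continuousAt.2 fun a => ?_
  rw [← continuousWithinAt_univ]
  refine continuousWithinAt_smul_of_bounded 1 continuous_pImp.continuousWithinAt
    (fun b => (Circle.norm_coe _).le) fun h => ?_
  exact (isEmbedding_circle_coe.continuous.continuousAt.comp
    (continuousAt_phase h)).continuousWithinAt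

theorem continuous_separating : Continuous (separating κ : PrePhase n → _) := by
  unfold separating
  have h1 := continuous_pImp_smul_phase (n := n) (κ := κ)
  have h2 := continuous_pNrg (n := n) (κ := κ)
  have h3 := continuous_pAng (n := n)
  fun_prop

theorem Glue.pImp_smul_phase_eq {a b : PrePhase n} (hg : Glue (finRotate n) a b) :
    pImp κ a • (phase κ a : ℂ) = pImp κ b • (phase κ b : ℂ) := by
  rw [hg.pImp_eq]
  by_cases h0 : pImp κ a = 0
  · rw [h0, zero_smul, zero_smul]
  · rw [hg.phase_eq h0]

theorem Glue.separating_eq {a b : PrePhase n} (hg : Glue (finRotate n) a b) :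
    separating κ a = separating κ b := by
  have h1 := hg.pImp_smul_phase_eq (κ := κ)
  have h2 := hg.pNrg_eq (κ := κ)
  have h3 := hg.pAng_eq
  unfold separating
  rw [h1, h2, h3]
  obtain ⟨hx, -, rfl⟩ := hg
  simp [hx]

theorem smul_circle_inj {r s : ℝ} {y z : Circle} (hr : 0 ≤ r) (hs : 0 ≤ s)
    (h : r • (y : ℂ) = s • (z : ℂ)) : r = s ∧ (r ≠ 0 → y = z) := by
  have h1 := congrArg norm h
  simp only [norm_smul, Circle.norm_coe, mul_one, Real.norm_eq_abs, abs_of_nonneg hr,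
    abs_of_nonneg hs] at h1
  subst h1
  exact ⟨rfl, fun h0 => Circle.ext (smul_right_injective ℂ h0 h)⟩

theorem mk_eq_of_separating_eq (hκ : 0 < κ) {a b : PrePhase n}
    (h : separating κ a = separating κ b) : (Quot.mk _ a : Phase n) = Quot.mk _ b := by
  simp only [separating, Prod.mk.injEq] at h
  obtain ⟨hx, hp, hn, hf, hv⟩ := h
  have hx' : a.2.1 = b.2.1 := Subtype.ext hx
  obtain ⟨himp, hph⟩ := smul_circle_inj (pImp_nonneg a) (pImp_nonneg b) hp
  by_cases h0 : pImp κ a = 0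
  · exact mk_eq_of_pImp_eq_zero hκ h0 (himp ▸ h0) hf hx'
  · have h0' : pImp κ b ≠ 0 := himp ▸ h0
    rcases eq_or_of_phase_eq (hph h0) with ⟨hi, hu⟩ | ⟨hi, h1, h2⟩ | ⟨hi, h1, h2⟩
    · have hr : pRad a = pRad b := by rw [pRad_eq h0, pRad_eq h0', hu, himp]
      have hvv : a.2.2 = b.2.2 := by
        by_cases h1 : ‖(a.2.1 : ℂ)‖ = 1
        · refine state_ext_boundary h1 ?_ ?_
          · exact hr.trans (by rw [pRad, hx'])
          · exact hf.trans (by rw [pAng, hx'])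
        · rw [← hx] at hv
          refine smul_right_injective ℂ (r := (1 - ‖(a.2.1 : ℂ)‖ ^ 2 : ℝ)) ?_ hv
          intro h2
          have h3 : (‖(a.2.1 : ℂ)‖ - 1) * (‖(a.2.1 : ℂ)‖ + 1) = 0 := by linarith
          have := norm_nonneg (a.2.1 : ℂ)
          rcases mul_eq_zero.1 h3 with h4 | h4
          · exact h1 (by linarith)
          · linarith
      congr 1
      exact Prod.ext hi (Prod.ext hx' hvv)
    · exact Quot.sound (glue_of_frac hκ h0 hi h1 h2 hn hf hx')
    · exact (Quot.sound (glue_of_frac hκ h0' hi h1 h2 hn.symm hf.symm hx'.symm)).symm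

instance : T2Space (Phase n) := by
  have hc : Continuous (Quot.lift (separating 1) fun a b hg => hg.separating_eq : Phase n → _) :=
    continuous_quot_lift _ continuous_separating
  refine T2Space.of_injective_continuous ?_ hc
  rintro ⟨a⟩ ⟨b⟩ h
  exact mk_eq_of_separating_eq one_pos h

end PrePhase

section

/-! ### Parallel transport of fibres around the singularity -/

variable {n : ℕ} {κ : ℝ}

/-- The vectors `κ - s + i f` and `-h + i f`, where `s` is the impact speed, are never opposite.
Hence they wind equally often around the origin along any loop of values `(h, f) ≠ (0, 0)`. -/
theorem entry_mul_mem_slitPlane (hκ : 0 < κ) {h f : ℝ} (hne : (h, f) ≠ (0, 0))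
    (hf : 0 ≤ 2 * h + κ ^ 2 - f ^ 2) :
    (⟨κ - impact κ h f, f⟩ * ⟨-h, -f⟩ : ℂ) ∈ Complex.slitPlane := by
  have hs : impact κ h f ^ 2 = 2 * h + κ ^ 2 - f ^ 2 := Real.sq_sqrt hf
  have hs0 := impact_nonneg (κ := κ) (h := h) (f := f)
  set s := impact κ h f
  rw [Complex.mem_slitPlane_iff]
  simp only [Complex.mul_re, Complex.mul_im]
  by_cases hf0 : f = 0
  · left
    subst hf0
    have hh : h ≠ 0 := fun hh => hne (by rw [hh])
    have h1 : (κ - s) * (κ + s) = -2 * h := by linear_combination -hs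
    have h2 : 0 < (κ - s) * -h := by
      have : 0 < (κ - s) * -h * (κ + s) := by
        have : (κ - s) * -h * (κ + s) = 2 * h ^ 2 := by linear_combination -h * h1
        rw [this]; positivity
      exact (pos_iff_pos_of_mul_pos this).2 (by linarith)
    linarith
  · by_contra hcon
    push Not at hcon
    obtain ⟨h1, h2⟩ := hcon
    have h3 : f * (κ - s + h) = 0 := by linear_combination -h2
    have h4 : κ - s = -h := by linarith [(mul_eq_zero.1 h3).resolve_left hf0]
    rw [h4] at h1
    have : 0 < f ^ 2 := by positivity
    nlinarith [sq_nonneg h]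

/-- The fibres over a loop around `(0, 0)` are parametrized continuously by a torus. The transport
around the loop adds `n` copies of the first basic cycle to the second one: the entry angle `A`
changes by `± 2π`, and this multiplies the rotation angle by the `n`-th power of the progress. -/
theorem exists_transport (hn : 0 < n) (hκ : 0 < κ) {γ : C(unitInterval, ℝ × ℝ)}
    (hγ : TurnsOnceAround (0, 0) γ) (hreg : ∀ t, ((γ t).2 ^ 2 + -κ ^ 2) / 2 < (γ t).1) :
    ∃ Φ : C(unitInterval × (Circle × Circle), Phase n),
      (∀ t, IsEmbedding (fun z => Φ (t, z)) ∧
        range (fun z => Φ (t, z)) = momentum n (-κ ^ 2) ⁻¹' {γ t}) ∧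
      γ 1 = γ 0 ∧ ∀ z w, Φ (1, (z, w)) = Φ (0, (z * w ^ n, w)) := by
  obtain ⟨ρ, θ, hρ, hρ1, hθ1, hpolar⟩ := hγ
  simp only [zero_add] at hpolar
  have hdisc : ∀ t, 0 < 2 * (γ t).1 + κ ^ 2 - (γ t).2 ^ 2 := fun t => by linarith [hreg t]
  have hne : ∀ t, ((γ t).1, (γ t).2) ≠ (0, 0) := by
    intro t ht
    rw [hpolar t, Prod.mk.injEq] at ht
    simp only at ht
    have h1 := (mul_eq_zero.1 ht.1).resolve_left (hρ t).ne'
    have h2 := (mul_eq_zero.1 ht.2).resolve_left (hρ t).ne'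
    have := Real.sin_sq_add_cos_sq (θ t)
    rw [h1, h2] at this
    norm_num at this
  have himp : ∀ t, impact κ (γ t).1 (γ t).2 ≠ 0 := fun t => (Real.sqrt_pos.2 (hdisc t)).ne'
  have hγ10 : γ 1 = γ 0 := by
    have : ∃ m : ℤ, θ 1 = θ 0 + m * (2 * Real.pi) := by
      rcases abs_choice (θ 1 - θ 0) with h | h <;> rw [h] at hθ1
      · exact ⟨1, by push_cast; linarith⟩
      · exact ⟨-1, by push_cast; linarith⟩
    obtain ⟨m, hm⟩ := this
    rw [hpolar 1, hpolar 0, hρ1, hm, Real.cos_add_int_mul_two_pi, Real.sin_add_int_mul_two_pi]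
  -- the entry angle, continuous along the loop
  set w : unitInterval → ℂ := fun t =>
    ⟨κ - impact κ (γ t).1 (γ t).2, (γ t).2⟩ * ⟨-(γ t).1, -(γ t).2⟩
  set A : unitInterval → ℝ := fun t => (Real.pi - θ t) + (w t).arg
  have hwc : Continuous w := by
    have h1 : Continuous fun t => impact κ (γ t).1 (γ t).2 := by unfold impact; fun_prop
    exact (Complex.equivRealProdCLM.symm.continuous.comp
      ((continuous_const.sub h1).prodMk (by fun_prop))).mul
      (Complex.equivRealProdCLM.symm.continuous.comp
        (Continuous.prodMk (f := fun t => -(γ t).1) (by fun_prop) (by fun_prop)))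
  have hAc : Continuous A := by
    refine (continuous_const.sub θ.continuous).add (continuous_iff_continuousAt.2 fun t => ?_)
    exact ContinuousAt.comp (f := w) (g := Complex.arg)
      (Complex.continuousAt_arg (entry_mul_mem_slitPlane hκ (hne t) (hdisc t).le)) hwc.continuousAt
  have hA : ∀ t, IsEntryArg κ (γ t).1 (γ t).2 (A t) := by
    intro t
    have hz : (⟨-(γ t).1, (γ t).2⟩ : ℂ) = (ρ t : ℂ) * Circle.exp (Real.pi - θ t) := by
      rw [Circle.coe_exp, hpolar t]
      apply Complex.ext
      · rw [Complex.re_ofReal_mul, Complex.exp_ofReal_mul_I_re, Real.cos_pi_sub]; ring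
      · rw [Complex.im_ofReal_mul, Complex.exp_ofReal_mul_I_im, Real.sin_pi_sub]
    have hz0 : (⟨-(γ t).1, (γ t).2⟩ : ℂ) ≠ 0 := by
      rw [hz]
      exact mul_ne_zero (by exact_mod_cast (hρ t).ne') (Circle.coe_ne_zero _)
    have hw : w t = ⟨κ - impact κ (γ t).1 (γ t).2, (γ t).2⟩ *
        starRingEnd ℂ ⟨-(γ t).1, (γ t).2⟩ := rfl
    have hd := dir_eq_of_mul (hρ t) hz
    rw [IsEntryArg]
    simp only [A]
    rw [Circle.exp_add, exp_arg_eq_dir, hw, dir_mul (sub_impact_ne_zero (hne t) (hdisc t).le)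
      (by simpa using hz0), dir_conj hz0, hd, mul_comm (dir _), mul_inv_cancel_left]
  -- `e` adjusts the orientation of the rotation to the direction of the loop
  obtain ⟨e, hec, hee, he⟩ : ∃ e : Circle → Circle, Continuous e ∧ (∀ z, e (e z) = z) ∧
      ∀ a : PrePhase n, e (gauge κ (A 0) a) = e (gauge κ (A 1) a) * phase κ a ^ n := by
    have hw10 : w 1 = w 0 := by simp only [w, hγ10]
    rcases abs_choice (θ 1 - θ 0) with h | h <;> rw [h] at hθ1
    · refine ⟨id, continuous_id, fun z => rfl, fun a => ?_⟩
      have : A 0 = A 1 + 2 * Real.pi := by simp only [A, hw10]; linarith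
      rw [this]
      exact gauge_add_two_pi hn a
    · refine ⟨fun z => z⁻¹, continuous_inv, inv_inv, fun a => ?_⟩
      have : A 1 = A 0 + 2 * Real.pi := by simp only [A, hw10]; linarith
      simp only
      rw [this, gauge_add_two_pi hn a, mul_inv, inv_mul_cancel_right]
  set K : Set (unitInterval × PrePhase n) :=
    {p | pNrg κ p.2 = (γ p.1).1 ∧ pAng p.2 = (γ p.1).2}
  have hK : IsCompact K := by
    obtain ⟨B, hB⟩ := (isCompact_range (by fun_prop : Continuous fun t => (γ t).1)).bddAbove
    have h1 := continuous_pNrg (n := n) (κ := κ)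
    have h2 := continuous_pAng (n := n)
    refine (isCompact_univ.prod (isCompact_pNrg_le κ B)).of_isClosed_subset ?_ ?_
    · exact (isClosed_eq (by fun_prop) (by fun_prop)).inter
        (isClosed_eq (by fun_prop) (by fun_prop))
    · rintro ⟨t, a⟩ ha
      exact ⟨mem_univ _, (ha.1.trans_le (hB ⟨t, rfl⟩) : pNrg κ a ≤ B)⟩
  have hKimp : ∀ p ∈ K, pImp κ p.2 ≠ 0 := by
    intro p hp
    rw [pImp, hp.1, hp.2]
    exact himp p.1
  have hKne : ∀ p ∈ K, (pNrg κ p.2, pAng p.2) ≠ (0, 0) := by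
    intro p hp
    rw [hp.1, hp.2]
    exact hne p.1
  -- coordinates on the union of the fibres over the loop
  set q : unitInterval × PrePhase n → unitInterval × (Circle × Circle) :=
    fun p => (p.1, (e (gauge κ (A p.1) p.2), phase κ p.2))
  set j : unitInterval × PrePhase n → unitInterval × Phase n := fun p => (p.1, Quot.mk _ p.2)
  have hqc : ContinuousOn q K := by
    refine continuousOn_fst.prodMk (ContinuousOn.prodMk ?_ ?_)
    · refine hec.comp_continuousOn fun p hp => ?_
      exact continuousWithinAt_gauge hκ (A := fun p : unitInterval × PrePhase n => A p.1)
        (hAc.comp continuous_fst).continuousWithinAt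
        continuousWithinAt_snd (hKne p hp) (fun h0 => absurd h0 (hKimp p hp))
    · exact fun p hp => (continuousAt_phase (hKimp p hp)).comp_continuousWithinAt
        continuousWithinAt_snd
  have hqs : ∀ t, ∃ p ∈ K, q p = t := by
    rintro ⟨t, z, y⟩
    obtain ⟨a, h1, h2, h3, h4⟩ := exists_of_gauge hn hκ (hne t) (hdisc t) (A t) (e z) y
    refine ⟨(t, a), ⟨h1, h2⟩, ?_⟩
    simp only [q, h3, h4, hee]
  have hjc : Continuous j := continuous_fst.prodMk (continuous_quot_mk.comp continuous_snd)
  have hqj : ∀ p ∈ K, ∀ p' ∈ K, (q p = q p' ↔ j p = j p') := by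
    rintro ⟨t, a⟩ ha ⟨t', b⟩ hb
    simp only [q, j, Prod.mk.injEq]
    refine and_congr_right fun ht => ?_
    subst ht
    rw [mk_eq_iff hκ (himp t) (hne t) (hA t) ha hb, (Function.LeftInverse.injective hee).eq_iff]
  obtain ⟨V, hV, hVr, hVq⟩ := exists_isEmbedding_of_continuousOn hK hqc hqs hjc.continuousOn hqj
  simp only [q, j] at hVq hVr
  have hVfst : ∀ t z, (V (t, z)).1 = t := by
    rintro t ⟨z, y⟩
    obtain ⟨a, h1, h2, h3, h4⟩ := exists_of_gauge hn hκ (hne t) (hdisc t) (A t) (e z) y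
    have := hVq (t, a) ⟨h1, h2⟩
    simp only [h3, h4, hee] at this
    rw [this]
  have hVs : ∀ t z, V (t, z) = (t, (V (t, z)).2) := fun t z => Prod.ext (hVfst t z) rfl
  refine ⟨⟨fun p => (V p).2, continuous_snd.comp hV.continuous⟩, fun t => ⟨?_, ?_⟩, hγ10, ?_⟩
  · have hemb : IsEmbedding fun z => V (t, z) := hV.comp (isEmbedding_prodMkRight t)
    refine IsEmbedding.of_comp (g := fun P : Phase n => (t, P))
      (continuous_snd.comp hemb.continuous) (by fun_prop) ?_
    convert hemb using 1
    funext z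
    exact (hVs t z).symm
  · ext P
    constructor
    · rintro ⟨z, rfl⟩
      obtain ⟨⟨t', a⟩, ha, hP⟩ := hVr.subset (mem_range_self (t, z))
      rw [hVs t z, Prod.mk.injEq] at hP
      simp only at hP
      obtain ⟨rfl, hP⟩ := hP
      change momentum n (-κ ^ 2) (V (t', z)).2 = γ t'
      rw [← hP, momentum_mk, ha.1, ha.2]
    · intro hP
      induction P using Quot.ind with
      | mk a =>
        have hP' : (pNrg κ a, pAng a) = γ t := hP
        have ha : (t, a) ∈ K := ⟨congrArg Prod.fst hP', congrArg Prod.snd hP'⟩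
        exact ⟨_, congrArg Prod.snd (hVq _ ha)⟩
  -- the same state is read off with the entry angles at both ends of the loop
  · intro z y
    obtain ⟨a, h1, h2, h3, h4⟩ := exists_of_gauge hn hκ (hne 1) (hdisc 1) (A 1) (e z) y
    have e1 := hVq (1, a) ⟨h1, h2⟩
    have e0 := hVq (0, a) ⟨h1.trans (by rw [hγ10]), h2.trans (by rw [hγ10])⟩
    simp only [he a, h3, h4, hee] at e1 e0
    change (V _).2 = (V _).2
    rw [e1, e0]

/-! ### Transitions between bases of cycles -/

theorem freelyHomotopicIn_of_eq {M : Type*} [TopologicalSpace M] {S : Set M} {a b : Circle → M}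
    (ha : Continuous a) (hS : ∀ z, a z ∈ S) (h : ∀ z, a z = b z) : FreelyHomotopicIn S a b :=
  ⟨⟨fun p => a p.2, ha.comp continuous_snd⟩, fun _ => rfl, h, fun p => hS p.2⟩

theorem continuous_cycle {M : Type*} [TopologicalSpace M] {e : Circle × Circle → M}
    (he : Continuous e) (a b : ℤ) : Continuous (cycle e a b) :=
  he.comp ((continuous_zpow a).prodMk (continuous_zpow b))

theorem isTransition_of_eq {M : Type*} [TopologicalSpace M] {S : Set M} {e e' : Circle × Circle → M}
    {A : Matrix (Fin 2) (Fin 2) ℤ} (he : Continuous e') (hS : ∀ z, e' z ∈ S)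
    (h0 : ∀ z, cycle e' 1 0 z = cycle e (A 0 0) (A 0 1) z)
    (h1 : ∀ z, cycle e' 0 1 z = cycle e (A 1 0) (A 1 1) z) : IsTransition S e e' A :=
  ⟨freelyHomotopicIn_of_eq (continuous_cycle he _ _) (fun _ => hS _) h0,
    freelyHomotopicIn_of_eq (continuous_cycle he _ _) (fun _ => hS _) h1⟩

theorem hasMonodromy (hn : 0 < n) (hκ : 0 < κ) {γ : C(unitInterval, ℝ × ℝ)}
    (hγ : TurnsOnceAround (0, 0) γ) (hreg : ∀ t, ((γ t).2 ^ 2 + -κ ^ 2) / 2 < (γ t).1) :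
    HasMonodromy (momentum n (-κ ^ 2)) γ !![1, 0; (n : ℤ), 1] := by
  obtain ⟨Φ, h1, h2, h3⟩ := exists_transport hn hκ hγ hreg
  refine ⟨Φ, h1, isTransition_of_eq (h1 1).1.continuous (fun z => ?_) (fun z => ?_) (fun z => ?_)⟩
  · rw [← h2, ← (h1 1).2]
    exact mem_range_self z
  · simp [cycle, h3]
  · simp [cycle, h3]

end

/-! ### Winding numbers of loops on a torus -/

theorem exists_lift (F : C(ℝ × ℝ, Circle)) : ∃ L : C(ℝ × ℝ, ℝ), ∀ p, Circle.exp (L p) = F p := by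
  obtain ⟨L, ⟨-, hL⟩, -⟩ := Circle.isCoveringMap_exp.existsUnique_continuousMap_lifts F
    (a₀ := (0, 0)) (e₀ := (F (0, 0) : ℂ).arg) (Circle.exp_arg _)
  exact ⟨L, fun p => congrFun hL p⟩

theorem exists_eq_const_of_exp_eq_one {X : Type*} [TopologicalSpace X] [PreconnectedSpace X]
    [Nonempty X] {D : X → ℝ} (hD : Continuous D) (h : ∀ p, Circle.exp (D p) = 1) :
    ∃ m : ℤ, ∀ p, D p = 2 * Real.pi * m := by
  obtain ⟨p₀⟩ := ‹Nonempty X›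
  obtain ⟨m, hm⟩ := Circle.exp_eq_one.1 (h p₀)
  refine ⟨m, fun p => ?_⟩
  have := Circle.isCoveringMap_exp.eq_of_comp_eq hD (continuous_const (y := D p₀))
    (funext fun p => (h p).trans (h p₀).symm) p₀ rfl
  rw [congrFun this p, hm]
  ring

/-- The loop `c` on the circle has winding number `d`: along a lift, the angle grows by `2πd`. -/
def IsWinding (c : Circle → Circle) (d : ℤ) : Prop :=
  ∃ L : C(ℝ, ℝ), (∀ s, Circle.exp (L s) = c (Circle.exp s)) ∧
    ∀ s, L (s + 2 * Real.pi) = L s + d * (2 * Real.pi)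

theorem IsWinding.unique {c : Circle → Circle} {d d' : ℤ} (h : IsWinding c d)
    (h' : IsWinding c d') : d = d' := by
  obtain ⟨L, h1, h2⟩ := h
  obtain ⟨L', h1', h2'⟩ := h'
  obtain ⟨m, hm⟩ := exists_eq_const_of_exp_eq_one (D := fun s => L s - L' s) (by fun_prop)
    fun s => by rw [Circle.exp_sub, h1, h1', div_self']
  have e0 := hm 0
  have e1 := hm (0 + 2 * Real.pi)
  rw [h2, h2'] at e1
  have : (d : ℝ) * (2 * Real.pi) = d' * (2 * Real.pi) := by linarith
  exact_mod_cast mul_right_cancel₀ Real.two_pi_pos.ne' this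

theorem isWinding_zpow (a : ℤ) : IsWinding (fun z => z ^ a) a :=
  ⟨⟨fun s => a * s, by fun_prop⟩, fun s => Circle.exp_intCast_mul s a, fun s => by simp; ring⟩

theorem IsWinding.mul_pow {c c' : Circle → Circle} {d d' : ℤ} (h : IsWinding c d)
    (h' : IsWinding c' d') (n : ℕ) : IsWinding (fun z => c z * c' z ^ n) (d + n * d') := by
  obtain ⟨L, h1, h2⟩ := h
  obtain ⟨L', h1', h2'⟩ := h'
  refine ⟨⟨fun s => L s + n * L' s, by fun_prop⟩, fun s => ?_, fun s => ?_⟩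
  · simp [Circle.exp_add, h1, h1']
  · simp only [ContinuousMap.coe_mk, h2, h2']
    push_cast
    ring

theorem add_int_mul_of_add {g : ℝ → ℝ} {T C : ℝ} (h : ∀ s, g (s + T) = g s + C) (a : ℤ) (s : ℝ) :
    g (s + a * T) = g s + a * C := by
  induction a using Int.induction_on generalizing s with
  | zero => simp
  | succ i ih =>
    have : s + ((i : ℤ) + 1 : ℤ) * T = (s + (i : ℤ) * T) + T := by push_cast; ring
    rw [this, h, ih]; push_cast; ring
  | pred i ih =>
    have := h (s + ((-(i : ℤ) - 1 : ℤ)) * T)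
    have e : s + ((-(i : ℤ) - 1 : ℤ)) * T + T = s + (-(i : ℤ) : ℤ) * T := by push_cast; ring
    rw [e, ih] at this
    push_cast at this ⊢
    linarith

/-- A circle-valued map on the torus acts on winding numbers as a linear form. -/
theorem exists_winding_form {f : Circle × Circle → Circle} (hf : Continuous f) :
    ∃ d₁ d₂ : ℤ, ∀ (c₁ c₂ : Circle → Circle) (a b : ℤ), IsWinding c₁ a → IsWinding c₂ b →
      IsWinding (fun z => f (c₁ z, c₂ z)) (a * d₁ + b * d₂) := by
  obtain ⟨L, hL⟩ := exists_lift ⟨fun p => f (Circle.exp p.1, Circle.exp p.2), by fun_prop⟩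
  simp only [ContinuousMap.coe_mk] at hL
  obtain ⟨d₁, h₁⟩ := exists_eq_const_of_exp_eq_one
    (D := fun p : ℝ × ℝ => L (p.1 + 2 * Real.pi, p.2) - L p) (by fun_prop)
    fun p => by rw [Circle.exp_sub, hL, hL]; simp
  obtain ⟨d₂, h₂⟩ := exists_eq_const_of_exp_eq_one
    (D := fun p : ℝ × ℝ => L (p.1, p.2 + 2 * Real.pi) - L p) (by fun_prop)
    fun p => by rw [Circle.exp_sub, hL, hL]; simp
  have h₁' : ∀ s t, L (s + 2 * Real.pi, t) = L (s, t) + 2 * Real.pi * d₁ := fun s t => by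
    rw [← h₁ (s, t)]; ring
  have h₂' : ∀ s t, L (s, t + 2 * Real.pi) = L (s, t) + 2 * Real.pi * d₂ := fun s t => by
    rw [← h₂ (s, t)]; ring
  refine ⟨d₁, d₂, ?_⟩
  rintro c₁ c₂ a b ⟨L₁, hL₁, hp₁⟩ ⟨L₂, hL₂, hp₂⟩
  refine ⟨⟨fun s => L (L₁ s, L₂ s), by fun_prop⟩, fun s => ?_, fun s => ?_⟩
  · simp [hL, hL₁, hL₂]
  · simp only [ContinuousMap.coe_mk, hp₁, hp₂]
    rw [add_int_mul_of_add (g := fun s => L (s, _)) (C := 2 * Real.pi * d₁)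
        (fun s => h₁' s _),
      add_int_mul_of_add (g := fun t => L (L₁ s, t)) (C := 2 * Real.pi * d₂)
        (fun t => h₂' _ t)]
    push_cast
    ring

theorem IsWinding.eq_of_homotopy {K : unitInterval × Circle → Circle} (hK : Continuous K)
    {d d' : ℤ} (h0 : IsWinding (fun z => K (0, z)) d) (h1 : IsWinding (fun z => K (1, z)) d') :
    d = d' := by
  obtain ⟨L, hL⟩ := exists_lift ⟨fun p => K (projIcc 0 1 zero_le_one p.1, Circle.exp p.2), by
    have := continuous_projIcc (a := (0 : ℝ)) (b := 1) (h := zero_le_one)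
    fun_prop⟩
  simp only [ContinuousMap.coe_mk] at hL
  obtain ⟨m, hm⟩ := exists_eq_const_of_exp_eq_one
    (D := fun p : ℝ × ℝ => L (p.1, p.2 + 2 * Real.pi) - L p) (by fun_prop)
    fun p => by rw [Circle.exp_sub, hL, hL]; simp
  have key : ∀ t : ℝ, IsWinding (fun z => K (projIcc 0 1 zero_le_one t, z)) m := fun t =>
    ⟨⟨fun s => L (t, s), by fun_prop⟩, fun s => hL (t, s), fun s => by
      simp only [ContinuousMap.coe_mk]
      linarith [hm (t, s)]⟩
  have k0 := key 0
  have k1 := key 1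
  rw [projIcc_left] at k0
  rw [projIcc_right] at k1
  exact (h0.unique k0).trans (k1.unique h1)

theorem exists_continuous_lift_of_isEmbedding {X Y M : Type*} [TopologicalSpace X]
    [TopologicalSpace Y] [TopologicalSpace M] {e : Y → M} (he : IsEmbedding e) {f : X → M}
    (hf : Continuous f) (h : ∀ x, f x ∈ range e) :
    ∃ g : X → Y, Continuous g ∧ ∀ x, e (g x) = f x := by
  choose g hg using h
  refine ⟨g, he.continuous_iff.2 ?_, hg⟩
  have : e ∘ g = f := funext hg
  rwa [this]

/-- Freely homotopic loops on an embedded torus have the same winding numbers. -/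
theorem winding_eq_of_freelyHomotopicIn {M : Type*} [TopologicalSpace M] {S : Set M}
    {e : Circle × Circle → M} (he : IsEmbedding e) (hS : range e = S)
    {c c' : Circle → Circle × Circle} {a b a' b' : ℤ}
    (h : FreelyHomotopicIn S (fun z => e (c z)) (fun z => e (c' z)))
    (ha : IsWinding (fun z => (c z).1) a) (hb : IsWinding (fun z => (c z).2) b)
    (ha' : IsWinding (fun z => (c' z).1) a') (hb' : IsWinding (fun z => (c' z).2) b') :
    a = a' ∧ b = b' := by
  obtain ⟨K, h0, h1, hK⟩ := h
  obtain ⟨k, hkc, hk⟩ := exists_continuous_lift_of_isEmbedding he K.continuous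
    (fun p => hS.symm ▸ hK p)
  have e0 : ∀ z, k (0, z) = c z := fun z => he.injective (by rw [hk, h0])
  have e1 : ∀ z, k (1, z) = c' z := fun z => he.injective (by rw [hk, h1])
  constructor
  · exact IsWinding.eq_of_homotopy (K := fun p => (k p).1) (by fun_prop)
      (by simpa only [e0] using ha) (by simpa only [e1] using ha')
  · exact IsWinding.eq_of_homotopy (K := fun p => (k p).2) (by fun_prop)
      (by simpa only [e0] using hb) (by simpa only [e1] using hb')

/-! ### Uniqueness of the monodromy label -/

/-- If some parametrization of the fibres over a loop has transport `(z, w) ↦ (z w ^ n, w)`, then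
`n` is the only label `m ≥ 0` of the loop: a change of the parametrization conjugates the monodromy
matrix by the action of a torus homeomorphism on winding numbers, which is invertible over `ℤ`. -/
theorem label_unique {M : Type*} [TopologicalSpace M] [T2Space M] {𝓕 : M → ℝ × ℝ}
    {γ : C(unitInterval, ℝ × ℝ)} {n m : ℕ} (hn : 0 < n)
    {Φ : C(unitInterval × (Circle × Circle), M)}
    (hΦ : ∀ t, IsEmbedding (fun z => Φ (t, z)) ∧ range (fun z => Φ (t, z)) = 𝓕 ⁻¹' {γ t})
    (htr : ∀ z w, Φ (1, (z, w)) = Φ (0, (z * w ^ n, w)))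
    (hm : HasMonodromy 𝓕 γ !![1, 0; (m : ℤ), 1]) : m = n := by
  obtain ⟨Ψ, hΨ, ht1, ht2⟩ := hm
  -- `Ψ t = Φ t ∘ g t` for a homotopy `g` of maps of the torus
  have hemb : IsEmbedding fun p : unitInterval × (Circle × Circle) => (p.1, Φ p) := by
    refine (Continuous.isClosedEmbedding (by fun_prop) ?_).isEmbedding
    rintro ⟨t, z⟩ ⟨t', z'⟩ h
    simp only [Prod.mk.injEq] at h
    obtain ⟨rfl, h⟩ := h
    rw [(hΦ t).1.injective h]
  obtain ⟨G, hGc, hG⟩ := exists_continuous_lift_of_isEmbedding hemb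
    (f := fun p : unitInterval × (Circle × Circle) => (p.1, Ψ p)) (by fun_prop) (by
      rintro ⟨t, z⟩
      have : Ψ (t, z) ∈ range fun z => Φ (t, z) := by
        rw [(hΦ t).2, ← (hΨ t).2]
        exact mem_range_self z
      obtain ⟨z', hz'⟩ := this
      exact ⟨(t, z'), Prod.ext rfl hz'⟩)
  set g : unitInterval × (Circle × Circle) → Circle × Circle := fun p => (G p).2
  have hg : ∀ t z, Φ (t, g (t, z)) = Ψ (t, z) := by
    intro t z
    have h := hG (t, z)
    simp only [Prod.mk.injEq] at h
    rw [← h.2]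
    exact congrArg Φ (Prod.ext h.1.symm rfl)
  have hgc : Continuous g := by fun_prop
  obtain ⟨gi, hgic, hgi⟩ := exists_continuous_lift_of_isEmbedding (hΨ 0).1
    (f := fun z => Φ (0, z)) (by fun_prop) (fun z => by
      rw [(hΨ 0).2, ← (hΦ 0).2]
      exact mem_range_self z)
  have hinv : ∀ z, gi (g (0, z)) = z := fun z => (hΨ 0).1.injective (by
    simp only [hgi, hg])
  -- the matrix of `g 0` on winding numbers is `(p r; q s)`
  obtain ⟨p, r, hx⟩ := exists_winding_form (f := fun z => (g (0, z)).1) (by fun_prop)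
  obtain ⟨q, s, hy⟩ := exists_winding_form (f := fun z => (g (0, z)).2) (by fun_prop)
  obtain ⟨P, R, hX⟩ := exists_winding_form (f := fun z => (gi z).1) (by fun_prop)
  obtain ⟨Q, S, hY⟩ := exists_winding_form (f := fun z => (gi z).2) (by fun_prop)
  obtain ⟨p₁, r₁, hx₁⟩ := exists_winding_form (f := fun z => (g (1, z)).1) (by fun_prop)
  obtain ⟨q₁, s₁, hy₁⟩ := exists_winding_form (f := fun z => (g (1, z)).2) (by fun_prop)
  have wx := fun a b => hx _ _ a b (isWinding_zpow a) (isWinding_zpow b)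
  have wy := fun a b => hy _ _ a b (isWinding_zpow a) (isWinding_zpow b)
  have wx₁ := fun a b => hx₁ _ _ a b (isWinding_zpow a) (isWinding_zpow b)
  have wy₁ := fun a b => hy₁ _ _ a b (isWinding_zpow a) (isWinding_zpow b)
  have ex : ∀ a b : ℤ, a * p + b * r = a * p₁ + b * r₁ := fun a b =>
    IsWinding.eq_of_homotopy (K := fun u => (g (u.1, (u.2 ^ a, u.2 ^ b))).1) (by fun_prop)
      (wx a b) (wx₁ a b)
  have ey : ∀ a b : ℤ, a * q + b * s = a * q₁ + b * s₁ := fun a b =>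
    IsWinding.eq_of_homotopy (K := fun u => (g (u.1, (u.2 ^ a, u.2 ^ b))).2) (by fun_prop)
      (wy a b) (wy₁ a b)
  have key : ∀ a b c d : ℤ, FreelyHomotopicIn (𝓕 ⁻¹' {γ 0}) (cycle (fun z => Ψ (1, z)) a b)
      (cycle (fun z => Ψ (0, z)) c d) →
      a * p + b * r + n * (a * q + b * s) = c * p + d * r ∧ a * q + b * s = c * q + d * s := by
    intro a b c d hab
    rw [ex a b, ey a b]
    refine winding_eq_of_freelyHomotopicIn (hΦ 0).1 (hΦ 0).2
      (c := fun z => ((g (1, (z ^ a, z ^ b))).1 * (g (1, (z ^ a, z ^ b))).2 ^ n,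
        (g (1, (z ^ a, z ^ b))).2)) (c' := fun z => g (0, (z ^ c, z ^ d))) ?_
      ((wx₁ a b).mul_pow (wy₁ a b) n) (wy₁ a b) (wx c d) (wy c d)
    simp only [← htr, hg, Prod.mk.eta]
    exact hab
  -- both transitions give `(1 0; m 1) (p q; r s) = (p q; r s) (1 0; n 1)`
  have k1 := key _ _ _ _ ht1
  have k2 := key _ _ _ _ ht2
  simp only [Matrix.of_apply, Matrix.cons_val', Matrix.cons_val_zero, Matrix.cons_val_one,
    Matrix.cons_val_fin_one, one_mul, zero_mul, add_zero, zero_add] at k1 k2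
  -- the torus map `gi` inverts `g 0`, so that the matrix is invertible over the integers
  have i1 : p * P + q * R = 1 := by
    have := hX _ _ _ _ (wx 1 0) (wy 1 0)
    simp only [Prod.mk.eta, hinv] at this
    have := this.unique (isWinding_zpow 1)
    linarith
  have i2 : p * Q + q * S = 0 := by
    have := hY _ _ _ _ (wx 1 0) (wy 1 0)
    simp only [Prod.mk.eta, hinv] at this
    have := this.unique (isWinding_zpow 0)
    linarith
  have i3 : r * Q + s * S = 1 := by
    have := hY _ _ _ _ (wx 0 1) (wy 0 1)
    simp only [Prod.mk.eta, hinv] at this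
    have := this.unique (isWinding_zpow 1)
    linarith
  have hn' : (n : ℤ) ≠ 0 := by exact_mod_cast hn.ne'
  have hq : q = 0 := (mul_eq_zero.1 (by linarith : (n : ℤ) * q = 0)).resolve_left hn'
  subst hq
  have hp : p * P = 1 := by linarith
  have hp0 : p ≠ 0 := left_ne_zero_of_mul_eq_one hp
  have hQ : Q = 0 := (mul_eq_zero.1 (by linarith : p * Q = 0)).resolve_left hp0
  subst hQ
  have hs : s * S = 1 := by linarith
  have h1 : p.natAbs = 1 := Int.natAbs_of_isUnit (IsUnit.of_mul_eq_one _ hp)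
  have h2 : s.natAbs = 1 := Int.natAbs_of_isUnit (IsUnit.of_mul_eq_one _ hs)
  have h3 : (n : ℤ) * s = m * p := by linarith [k2.1]
  have h4 := congrArg Int.natAbs h3
  rw [Int.natAbs_mul, Int.natAbs_mul, h1, h2] at h4
  simpa using h4.symm

/-- A small circle around `p`. -/
theorem exists_turnsOnceAround (p : ℝ × ℝ) {U : Set (ℝ × ℝ)} (hU : U ∈ 𝓝 p) :
    ∃ γ : C(unitInterval, ℝ × ℝ), TurnsOnceAround p γ ∧ ∀ t, γ t ∈ U := by
  obtain ⟨ε, hε, hb⟩ := Metric.mem_nhds_iff.1 hU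
  refine ⟨⟨fun t => (p.1 + ε / 2 * Real.cos (2 * Real.pi * t),
    p.2 + ε / 2 * Real.sin (2 * Real.pi * t)), by fun_prop⟩, ⟨ContinuousMap.const _ (ε / 2),
    ⟨fun t => 2 * Real.pi * t, by fun_prop⟩, fun _ => half_pos hε, rfl, ?_, fun t => rfl⟩, ?_⟩
  · simp [abs_of_pos Real.pi_pos]
  · intro t
    apply hb
    have h1 := Real.abs_cos_le_one (2 * Real.pi * t)
    have h2 := Real.abs_sin_le_one (2 * Real.pi * t)
    rw [Metric.mem_ball, Prod.dist_eq]
    simp only [ContinuousMap.coe_mk, Real.dist_eq, add_sub_cancel_left, abs_mul,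
      abs_of_pos (half_pos hε)]
    apply max_lt <;> nlinarith

theorem isMonodromyLabel_iff {n : ℕ} {κ : ℝ} (hn : 0 < n) (hκ : 0 < κ) (m : ℕ) :
    IsMonodromyLabel (momentum n (-κ ^ 2)) (0, 0) m ↔ m = n := by
  have hreg : {q : ℝ × ℝ | (q.2 ^ 2 + -κ ^ 2) / 2 < q.1} ∈ 𝓝 ((0, 0) : ℝ × ℝ) := by
    refine (isOpen_lt (by fun_prop) (by fun_prop)).mem_nhds ?_
    have : 0 < κ ^ 2 := by positivity
    change ((0 : ℝ) ^ 2 + -κ ^ 2) / 2 < 0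
    linarith
  constructor
  · rintro ⟨U, hU, h⟩
    obtain ⟨γ, hγ, hγU⟩ := exists_turnsOnceAround _ (Filter.inter_mem hU hreg)
    obtain ⟨Φ, h1, -, h3⟩ := exists_transport hn hκ hγ fun t => (hγU t).2
    exact label_unique hn h1 h3 (h γ hγ fun t => (hγU t).1)
  · rintro rfl
    exact ⟨_, hreg, fun γ hγ h => hasMonodromy hn hκ hγ h⟩

section

/-! ### Entry angles on an isoenergy surface -/

variable {n : ℕ} {κ h : ℝ}

/-- `A` is a continuous choice of the entry angle as a function of the angular momentum `f` on the
energy level `h`, such that entry and exit angle agree at the tangent states with `f ∈ S`. -/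
structure IsEntryBranch (κ h : ℝ) (S : Set ℝ) (A : ℝ → ℝ) : Prop where
  continuous : Continuous A
  entry : ∀ f, IsEntryArg κ h f (A f)
  tangent : ∀ f ∈ S, impact κ h f = 0 → A f = exitArg κ h f

theorem continuous_impact : Continuous fun f => impact κ h f := by
  unfold impact
  fun_prop

theorem continuous_complex_mk {X : Type*} [TopologicalSpace X] {f g : X → ℝ} (hf : Continuous f)
    (hg : Continuous g) : Continuous fun x => (⟨f x, g x⟩ : ℂ) :=
  Complex.equivRealProdCLM.symm.continuous.comp (hf.prodMk hg)

/-- For negative energies the entry angle has a branch on the whole energy level. -/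
theorem isEntryBranch_of_neg (hκ : 0 < κ) (h0 : h < 0) :
    IsEntryBranch κ h univ fun f => Complex.arg ⟨κ - impact κ h f, f⟩ := by
  refine ⟨continuous_iff_continuousAt.2 fun f => ?_, fun f => rfl, fun f _ hf => ?_⟩
  · refine ContinuousAt.comp (f := fun f => (⟨κ - impact κ h f, f⟩ : ℂ)) (g := Complex.arg)
      (Complex.continuousAt_arg ?_) (continuous_complex_mk
        (continuous_const.sub continuous_impact) continuous_id).continuousAt
    rw [Complex.mem_slitPlane_iff]
    by_cases hf : f = 0
    · left
      have : impact κ h f < κ := by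
        rw [impact, hf, Real.sqrt_lt' hκ]
        linarith
      simpa using this
    · exact Or.inr hf
  · simp only [exitArg, hf, sub_zero, add_zero]

/-- For positive energies there are two branches, one for each sign of the angular momentum, that
differ by a full turn. -/
theorem isEntryBranch_of_pos (h0 : 0 < h) {ε : ℤ} (hε : ε = 1 ∨ ε = -1) :
    IsEntryBranch κ h {f | 0 ≤ ε * f}
      fun f => Complex.arg (-⟨κ - impact κ h f, f⟩) + ε * Real.pi := by
  have hs : ∀ f, -⟨κ - impact κ h f, f⟩ ∈ Complex.slitPlane := by
    intro f
    rw [Complex.mem_slitPlane_iff]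
    by_cases hf : f = 0
    · left
      have : κ < impact κ h f := by
        rw [impact, hf]
        exact Real.lt_sqrt_of_sq_lt (by linarith)
      simpa using this
    · exact Or.inr (by simpa using hf)
  refine ⟨?_, fun f => ?_, fun f hf hi => ?_⟩
  · refine (continuous_iff_continuousAt.2 fun f => ?_).add continuous_const
    exact ContinuousAt.comp (f := fun f => -(⟨κ - impact κ h f, f⟩ : ℂ)) (g := Complex.arg)
      (Complex.continuousAt_arg (hs f)) (continuous_complex_mk
        (continuous_const.sub continuous_impact) continuous_id).neg.continuousAt
  · have hne := neg_ne_zero.1 (Complex.slitPlane_ne_zero (hs f))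
    have hpi : Circle.exp (ε * Real.pi) = Circle.exp Real.pi := by
      rcases hε with rfl | rfl
      · simp
      · rw [Circle.exp_eq_exp]
        exact ⟨-1, by push_cast; ring⟩
    rw [IsEntryArg, Circle.exp_add, exp_arg_eq_dir, hpi, dir_neg hne, mul_right_comm,
      ← Circle.exp_add, ← two_mul, Circle.exp_two_pi, one_mul]
  · have hf0 : f ≠ 0 := by
      rintro rfl
      have : 0 < impact κ h 0 := Real.sqrt_pos.2 (by nlinarith)
      exact this.ne' hi
    simp only [exitArg, hi, sub_zero, add_zero]
    rcases hε with rfl | rfl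
    · have : 0 < f := lt_of_le_of_ne (by simpa using hf) hf0.symm
      rw [Complex.arg_neg_eq_arg_sub_pi_of_im_pos this]
      push_cast
      ring
    · have : f < 0 := lt_of_le_of_ne (by simpa using hf) hf0
      rw [Complex.arg_neg_eq_arg_add_pi_of_im_neg this]
      push_cast
      ring

section Branch

variable {S : Set ℝ} {A : ℝ → ℝ}

theorem ne_of_nrg_eq (h0 : h ≠ 0) {a : PrePhase n} (ha : pNrg κ a = h) :
    (pNrg κ a, pAng a) ≠ (0, 0) := fun he => h0 (by
  rw [Prod.mk.injEq] at he
  rw [← ha, he.1])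

theorem IsEntryBranch.continuousOn_gauge (hA : IsEntryBranch κ h S A) (hκ : 0 < κ) (h0 : h ≠ 0) :
    ContinuousOn (fun a : PrePhase n => gauge κ (A (pAng a)) a)
      {a | pNrg κ a = h ∧ (pImp κ a = 0 → pAng a ∈ S)} := by
  rintro a ⟨ha, hS⟩
  refine continuousWithinAt_gauge hκ (A := fun a => A (pAng a)) (g := fun a => a)
    (hA.continuous.comp continuous_pAng).continuousWithinAt continuousWithinAt_id
    (ne_of_nrg_eq h0 ha) fun hi => ?_
  rw [hA.tangent _ (hS hi) (by rw [← ha]; exact hi), ha]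

theorem IsEntryBranch.gauge_eq (hA : IsEntryBranch κ h S A) (hκ : 0 < κ) (h0 : h ≠ 0)
    {a b : PrePhase n} (hg : Glue (finRotate n) a b) (ha : pNrg κ a = h)
    (hS : pImp κ a = 0 → pAng a ∈ S) :
    gauge κ (A (pAng a)) a = gauge κ (A (pAng b)) b := by
  rw [hg.pAng_eq]
  subst ha
  exact hg.gauge_eq hκ (ne_of_nrg_eq h0 rfl) (hA.entry _) fun hi => hA.tangent _ (hS hi) hi

theorem IsEntryBranch.gauge_of_pImp (hA : IsEntryBranch κ h S A) (hκ : 0 < κ) (h0 : h ≠ 0)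
    {a : PrePhase n} (ha : pNrg κ a = h) (hi : pImp κ a = 0) (hS : pAng a ∈ S) :
    gauge κ (A (pAng a)) a = dir (a.2.1 : ℂ) := by
  subst ha
  exact gauge_of_norm_eq_one hκ (norm_eq_one_of_pImp hκ hi) (ne_of_nrg_eq h0 rfl) (hA.entry _)
    fun hi => hA.tangent _ hS hi

/-- On an isoenergy surface, the point of phase space is determined by the angular momentum and the
rotation angle, together with the progress if the state is not tangent. -/
theorem IsEntryBranch.mk_eq (hA : IsEntryBranch κ h S A) (hκ : 0 < κ) (h0 : h ≠ 0)
    {a b : PrePhase n} (ha : pNrg κ a = h) (hb : pNrg κ b = h) (hf : pAng a = pAng b)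
    (hS : pImp κ a = 0 → pAng a ∈ S) (hp : pImp κ a ≠ 0 → phase κ a = phase κ b)
    (hg : gauge κ (A (pAng a)) a = gauge κ (A (pAng b)) b) :
    (Quot.mk _ a : Phase n) = Quot.mk _ b := by
  have himp : pImp κ a = pImp κ b := by rw [pImp, pImp, ha, hb, hf]
  by_cases hi : pImp κ a = 0
  · rw [hA.gauge_of_pImp hκ h0 ha hi (hS hi),
      hA.gauge_of_pImp hκ h0 hb (himp ▸ hi) (hf ▸ hS hi)] at hg
    exact mk_eq_of_pImp_eq_zero hκ hi (himp ▸ hi) hf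
      (dir_eq_position (norm_eq_one_of_pImp hκ hi) (norm_eq_one_of_pImp hκ (himp ▸ hi)) hg)
  · rw [← hf] at hg
    subst ha
    exact mk_eq_of_gauge_eq hκ hi (ne_of_nrg_eq h0 rfl) hb.symm hf (hA.entry _) (hp hi) hg

/-- Every angular momentum that is possible on the energy level occurs with every rotation angle,
and with every progress unless it belongs to tangent states. -/
theorem IsEntryBranch.exists_state (hA : IsEntryBranch κ h S A) (hn : 0 < n) (hκ : 0 < κ)
    (h0 : h ≠ 0) {f : ℝ} (hf : 0 ≤ 2 * h + κ ^ 2 - f ^ 2) (hS : impact κ h f = 0 → f ∈ S)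
    (θ y : Circle) : ∃ a : PrePhase n, pNrg κ a = h ∧ pAng a = f ∧
      gauge κ (A (pAng a)) a = θ ∧ (impact κ h f ≠ 0 → phase κ a = y) := by
  rcases hf.eq_or_lt with hf | hf
  · have hi : impact κ h f = 0 := by rw [impact, ← hf, Real.sqrt_zero]
    obtain ⟨a, e1, e2, e3, -⟩ := exists_tangent (n := n) hn hf.symm θ
    refine ⟨a, e1, e2, ?_, fun hc => absurd hi hc⟩
    rw [hA.gauge_of_pImp hκ h0 e1 (by rw [pImp, e1, e2, hi]) (e2 ▸ hS hi), e3, dir_coe]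
  · obtain ⟨a, e1, e2, e3, e4⟩ := exists_of_gauge (n := n) hn hκ (h := h) (f := f)
      (fun he => h0 (Prod.mk.inj he).1) hf (A f) θ y
    exact ⟨a, e1, e2, e2 ▸ e4, fun _ => e3⟩

end Branch

/-! ### The solid tori -/

/-- The largest angular momentum `√(2h + κ²)` on the energy level `h`. -/
def maxAng (κ h : ℝ) : ℝ := √(2 * h + κ ^ 2)

theorem maxAng_pos (h1 : -κ ^ 2 / 2 < h) : 0 < maxAng κ h := Real.sqrt_pos.2 (by linarith)

theorem maxAng_sq (h1 : -κ ^ 2 / 2 < h) : maxAng κ h ^ 2 = 2 * h + κ ^ 2 :=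
  Real.sq_sqrt (by linarith)

theorem impact_zero : impact κ h 0 = maxAng κ h := by simp [impact, maxAng]

theorem pImp_sq_add (h1 : -κ ^ 2 / 2 < h) {a : PrePhase n} (ha : pNrg κ a = h) :
    pImp κ a ^ 2 + pAng a ^ 2 = maxAng κ h ^ 2 := by
  have := impact_sq (κ := κ) (v := a.2.2) (norm_pos_le a)
  rw [← rad_sq_add] at this
  rw [maxAng_sq h1, ← ha, pImp, pNrg, pAng, this]
  ring

theorem pImp_le_maxAng (a : PrePhase n) : pImp κ a ≤ maxAng κ (pNrg κ a) :=
  Real.sqrt_le_sqrt (by nlinarith [sq_nonneg (pAng a)])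

/-- The meridian disk coordinate of a state: its argument is the progress, and its modulus is `0` at
tangent states and `1` at states of angular momentum `0`. -/
def diskCoord (κ : ℝ) (a : PrePhase n) : Disk :=
  ⟨(maxAng κ (pNrg κ a))⁻¹ • pImp κ a • (phase κ a : ℂ), by
    have h0 : 0 ≤ maxAng κ (pNrg κ a) := Real.sqrt_nonneg _
    rw [mem_closedBall_zero_iff, norm_smul, norm_smul, Circle.norm_coe, mul_one, Real.norm_eq_abs,
      Real.norm_eq_abs, abs_of_nonneg (pImp_nonneg a), abs_of_nonneg (inv_nonneg.2 h0)]
    rw [inv_mul_eq_div]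
    exact div_le_one_of_le₀ (pImp_le_maxAng a) h0⟩

theorem norm_diskCoord (a : PrePhase n) :
    ‖(diskCoord κ a : ℂ)‖ = pImp κ a / maxAng κ (pNrg κ a) := by
  have h0 : 0 ≤ maxAng κ (pNrg κ a) := Real.sqrt_nonneg _
  rw [diskCoord, norm_smul, norm_smul, Circle.norm_coe, mul_one, Real.norm_eq_abs,
    Real.norm_eq_abs, abs_of_nonneg (pImp_nonneg a), abs_of_nonneg (inv_nonneg.2 h0),
    inv_mul_eq_div]

theorem continuousOn_diskCoord (h1 : -κ ^ 2 / 2 < h) :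
    ContinuousOn (diskCoord κ) {a : PrePhase n | pNrg κ a = h} := by
  have h2 := continuous_pNrg (n := n) (κ := κ)
  have hc : Continuous fun a : PrePhase n => maxAng κ (pNrg κ a) := by
    unfold maxAng
    fun_prop
  refine IsInducing.subtypeVal.continuousOn_iff.2 fun a ha => ?_
  refine ((hc.continuousAt.inv₀ ?_).smul
    continuous_pImp_smul_phase.continuousAt).continuousWithinAt
  rw [ha]
  exact (maxAng_pos h1).ne'

theorem Glue.diskCoord_eq {a b : PrePhase n} (hg : Glue (finRotate n) a b) :
    diskCoord κ a = diskCoord κ b := by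
  apply Subtype.ext
  simp only [diskCoord, hg.pNrg_eq, hg.pImp_smul_phase_eq (κ := κ)]

theorem eq_of_diskCoord_eq (h1 : -κ ^ 2 / 2 < h) {a b : PrePhase n} (ha : pNrg κ a = h)
    (hb : pNrg κ b = h) (hd : diskCoord κ a = diskCoord κ b) :
    pImp κ a = pImp κ b ∧ (pImp κ a ≠ 0 → phase κ a = phase κ b) := by
  have h2 := congrArg Subtype.val hd
  simp only [diskCoord, ha, hb] at h2
  exact smul_circle_inj (pImp_nonneg a) (pImp_nonneg b)
    (smul_right_injective ℂ (inv_ne_zero (maxAng_pos h1).ne') h2)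

theorem zpow_sign_zpow_sign {ε : ℤ} (hε : ε = 1 ∨ ε = -1) (z : Circle) : (z ^ ε) ^ ε = z := by
  rcases hε with rfl | rfl <;> simp

/-- The part of an isoenergy surface where the angular momentum has a given sign `ε` is a solid
torus with meridian disk coordinate `diskCoord` and the rotation angle, oriented by `ε`, as
coordinate on the core. -/
theorem exists_isAtomA (hn : 0 < n) (hκ : 0 < κ) (h0 : h ≠ 0) (h1 : -κ ^ 2 / 2 < h) {ε : ℤ}
    (hε : ε = 1 ∨ ε = -1) {A : ℝ → ℝ} (hA : IsEntryBranch κ h {f | 0 ≤ ε * f} A) :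
    ∃ V : SolidTorus → Phase n,
      IsAtomA V {P | (momentum n (-κ ^ 2) P).1 = h ∧ 0 ≤ ε * (momentum n (-κ ^ 2) P).2} ∧
      ∀ a : PrePhase n, pNrg κ a = h → 0 ≤ ε * pAng a →
        V (diskCoord κ a, gauge κ (A (pAng a)) a ^ ε) = Quot.mk _ a := by
  have hm := maxAng_pos h1
  have hm2 := maxAng_sq h1
  have hεε : (ε : ℝ) * ε = 1 := by rcases hε with rfl | rfl <;> norm_num
  set K : Set (PrePhase n) := {a | pNrg κ a = h ∧ 0 ≤ ε * pAng a}
  have hK : IsCompact K := by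
    refine (isCompact_pNrg_le κ h).of_isClosed_subset ?_ fun a ha => ha.1.le
    exact (isClosed_eq continuous_pNrg continuous_const).inter
      (isClosed_le continuous_const (continuous_const.mul continuous_pAng))
  -- on either side the angular momentum is determined by the impact speed
  have hang : ∀ a ∈ K, ∀ b ∈ K, pImp κ a = pImp κ b → pAng a = pAng b := by
    intro a ha b hb hi
    have ea := pImp_sq_add h1 ha.1
    have eb := pImp_sq_add h1 hb.1
    have : (ε * pAng a) ^ 2 = (ε * pAng b) ^ 2 := by
      rw [mul_pow, mul_pow]
      rw [hi] at ea
      rw [show pAng a ^ 2 = pAng b ^ 2 by linarith]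
    have := (sq_eq_sq₀ ha.2 hb.2).1 this
    have := congrArg (fun t => (ε : ℝ) * t) this
    simpa only [← mul_assoc, hεε, one_mul] using this
  set q : PrePhase n → SolidTorus := fun a => (diskCoord κ a, gauge κ (A (pAng a)) a ^ ε)
  have hqc : ContinuousOn q K := by
    refine ContinuousOn.prodMk ((continuousOn_diskCoord h1).mono fun a ha => ha.1) ?_
    exact (continuous_zpow ε).comp_continuousOn
      ((hA.continuousOn_gauge hκ h0).mono fun a ha => ⟨ha.1, fun _ => ha.2⟩)
  have hqs : ∀ t, ∃ a ∈ K, q a = t := by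
    rintro ⟨d, z⟩
    have hd : ‖(d : ℂ)‖ ≤ 1 := mem_closedBall_zero_iff.1 d.2
    have hd' : 0 ≤ 1 - ‖(d : ℂ)‖ ^ 2 := by nlinarith [norm_nonneg (d : ℂ)]
    set f : ℝ := ε * (maxAng κ h * √(1 - ‖(d : ℂ)‖ ^ 2))
    have hf0 : 0 ≤ ε * f := by
      rw [← mul_assoc, hεε, one_mul]
      positivity
    have hf2 : f ^ 2 = maxAng κ h ^ 2 * (1 - ‖(d : ℂ)‖ ^ 2) := by
      rw [mul_pow, mul_pow, Real.sq_sqrt hd', pow_two (ε : ℝ), hεε, one_mul]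
    have hdisc : 2 * h + κ ^ 2 - f ^ 2 = (maxAng κ h * ‖(d : ℂ)‖) ^ 2 := by
      rw [hf2, ← hm2]; ring
    have hi : impact κ h f = maxAng κ h * ‖(d : ℂ)‖ := by
      rw [impact, hdisc, Real.sqrt_sq (by positivity)]
    obtain ⟨a, e1, e2, e3, e4⟩ := hA.exists_state hn hκ h0 (f := f) (hdisc ▸ sq_nonneg _)
      (fun _ => hf0) (z ^ ε) (dir d)
    refine ⟨a, ⟨e1, e2.symm ▸ hf0⟩, Prod.ext (Subtype.ext ?_) ?_⟩
    · simp only [q, diskCoord, pImp, e1, e2, hi]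
      rw [smul_smul, inv_mul_cancel_left₀ hm.ne']
      by_cases hd0 : (d : ℂ) = 0
      · rw [hd0]; simp
      · rw [e4 (by rw [hi]; exact mul_ne_zero hm.ne' (norm_ne_zero_iff.2 hd0)), Complex.real_smul,
          norm_mul_dir]
    · simp only [q]
      rw [e3, zpow_sign_zpow_sign hε]
  have hqj : ∀ a ∈ K, ∀ b ∈ K, (q a = q b ↔ (Quot.mk _ a : Phase n) = Quot.mk _ b) := by
    intro a ha b hb
    constructor
    · intro hq
      obtain ⟨hq1, hq2⟩ := Prod.mk.inj hq
      obtain ⟨hi, hp⟩ := eq_of_diskCoord_eq h1 ha.1 hb.1 hq1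
      refine hA.mk_eq hκ h0 ha.1 hb.1 (hang a ha b hb hi) (fun _ => ha.2) hp ?_
      rw [← zpow_sign_zpow_sign hε (gauge κ _ a), hq2, zpow_sign_zpow_sign hε]
    · intro hab
      refine eq_of_mk_eq (P := fun a => a ∈ K) (fun a b hg => ?_) (fun a b hg ha => ?_) hab ha
      · simp only [K]
        rw [mem_ofPred_eq, mem_ofPred_eq, hg.pNrg_eq, hg.pAng_eq]
      · simp only [q]
        rw [hg.diskCoord_eq, hA.gauge_eq hκ h0 hg ha.1 fun _ => ha.2]
  obtain ⟨V, hV, hVr, hVq⟩ := exists_isEmbedding_of_continuousOn hK hqc hqs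
    continuous_quot_mk.continuousOn hqj
  refine ⟨V, ⟨hV, ?_, ?_, ?_⟩, fun a ha hf => hVq a ⟨ha, hf⟩⟩
  · rw [hVr]
    ext P
    constructor
    · rintro ⟨a, ha, rfl⟩
      exact ha
    · induction P using Quot.ind with
      | mk a => exact fun ha => ⟨a, ha, rfl⟩
  · intro p p'
    obtain ⟨a, ha, rfl⟩ := hqs p
    obtain ⟨b, hb, rfl⟩ := hqs p'
    rw [hVq a ha, hVq b hb]
    change pAng a = pAng b ↔ ‖(diskCoord κ a : ℂ)‖ = ‖(diskCoord κ b : ℂ)‖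
    rw [norm_diskCoord, norm_diskCoord, ha.1, hb.1, div_left_inj' hm.ne']
    refine ⟨fun hf => ?_, hang a ha b hb⟩
    rw [pImp, pImp, ha.1, hb.1, hf]
  · -- the core consists of the tangent states, where the ball runs along the boundary circle
    have hf2 : (ε * maxAng κ h) ^ 2 = 2 * h + κ ^ 2 := by
      rw [mul_pow, pow_two (ε : ℝ), hεε, one_mul, hm2]
    choose c hc1 hc2 hc3 hc4 using fun t : ℝ => exists_tangent (n := n) hn (h := h) (κ := κ)
      (f := ε * maxAng κ h) (by rw [hf2, sub_self]) (Circle.exp (ε * maxAng κ h * t))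
    refine ⟨maxAng κ h, hm, c, fun t => ⟨?_, ?_⟩⟩
    · have hK' : c t ∈ K := ⟨hc1 t, by rw [hc2, ← mul_assoc, hεε, one_mul]; exact hm.le⟩
      have hi : pImp κ (c t) = 0 := by
        rw [pImp, hc1, hc2, impact, hf2, sub_self, Real.sqrt_zero]
      rw [← hVq _ hK']
      congr 1
      refine Prod.ext (Subtype.ext ?_) ?_
      · simp [q, diskCoord, hi]
      · simp only [q]
        rw [hA.gauge_of_pImp hκ h0 (hc1 t) hi hK'.2, hc3, dir_coe, ← Circle.exp_intCast_mul,
          ← mul_assoc, ← mul_assoc, hεε, one_mul]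
    · have : (fun s => ((c s).2.1 : ℂ)) =
          fun s : ℝ => Complex.exp (((ε * maxAng κ h * s : ℝ) : ℂ) * Complex.I) := by
        funext s
        rw [hc3, Circle.coe_exp]
      rw [this, hc4, Circle.coe_exp]
      have hd : HasDerivAt (fun s : ℝ => (((ε * maxAng κ h * s : ℝ) : ℂ) * Complex.I))
          (((ε * maxAng κ h : ℝ) : ℂ) * Complex.I) t := by
        have := ((hasDerivAt_id t).const_mul (ε * maxAng κ h)).ofReal_comp.mul_const Complex.I
        simpa using this
      convert hd.cexp using 1
      ring

/-! ### Gluing of the solid tori -/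

/-- If the rotation angles used on the two sides of `F = 0` differ by the `N`-th power of the
progress, then the gluing matrix is `(1 N; 0 -1)`. -/
theorem hasMoleculeAA (hn : 0 < n) (hκ : 0 < κ) (h0 : h ≠ 0) (h1 : -κ ^ 2 / 2 < h) {A B : ℝ → ℝ}
    (hA : IsEntryBranch κ h {f | 0 ≤ ((1 : ℤ) : ℝ) * f} A)
    (hB : IsEntryBranch κ h {f | 0 ≤ ((-1 : ℤ) : ℝ) * f} B) (N : ℕ)
    (hAB : ∀ a : PrePhase n, gauge κ (A 0) a = gauge κ (B 0) a * phase κ a ^ N) :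
    HasMoleculeAA n (-κ ^ 2) h !![1, (N : ℤ); 0, -1] := by
  obtain ⟨Vp, hVp, hp⟩ := exists_isAtomA hn hκ h0 h1 (Or.inl rfl) hA
  obtain ⟨Vm, hVm, hm⟩ := exists_isAtomA hn hκ h0 h1 (Or.inr rfl) hB
  have key : ∀ w z : Circle, Vp (bdry (w, z)) = Vm (bdry (w, z⁻¹ * w ^ N)) ∧
      momentum n (-κ ^ 2) (Vp (bdry (w, z))) = (h, 0) := by
    intro w z
    obtain ⟨a, e1, e2, e3, e4⟩ := exists_of_gauge (n := n) hn hκ (h := h) (f := 0)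
      (fun he => h0 (Prod.mk.inj he).1) (by linarith) (A 0) z w
    have hd : ∀ u, bdry (w, u) = (diskCoord κ a, u) := by
      intro u
      refine Prod.ext (Subtype.ext ?_) rfl
      have hi : pImp κ a = maxAng κ h := by rw [pImp, e1, e2, impact_zero]
      simp only [bdry, diskCoord, e1, e3, hi]
      rw [smul_smul, inv_mul_cancel₀ (maxAng_pos h1).ne', one_smul]
    have hp' := hp a e1 (by rw [e2]; simp)
    have hm' := hm a e1 (by rw [e2]; simp)
    have hB0 : gauge κ (B 0) a ^ (-1 : ℤ) = z⁻¹ * w ^ N := by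
      rw [← e4, hAB a, e3, zpow_neg_one, mul_inv, inv_mul_cancel_right]
    rw [e2, e4, zpow_one] at hp'
    rw [e2, hB0] at hm'
    rw [hd, hd, hp', hm']
    exact ⟨rfl, by rw [momentum_mk, e1, e2]⟩
  refine ⟨0, Vm, Vp, ?_, ?_, by simp [Matrix.det_fin_two], ?_⟩
  · simpa using hVm
  · simpa using hVp
  · have hb : Continuous bdry := by
      unfold bdry
      exact (Continuous.subtype_mk (isEmbedding_circle_coe.continuous.comp continuous_fst) _).prodMk
        continuous_snd
    refine isTransition_of_eq (hVp.isEmbedding.continuous.comp hb) (fun z => (key z.1 z.2).2)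
      (fun z => ?_) (fun z => ?_)
    · simp [cycle, (key _ _).1]
    · simp [cycle, (key _ _).1]

theorem hasMoleculeAA_of_neg (hn : 0 < n) (hκ : 0 < κ) (h1 : -κ ^ 2 / 2 < h) (h0 : h < 0) :
    HasMoleculeAA n (-κ ^ 2) h !![1, 0; 0, -1] := by
  have hA := isEntryBranch_of_neg hκ h0
  have hS : ∀ S, IsEntryBranch κ h S fun f => Complex.arg ⟨κ - impact κ h f, f⟩ := fun S =>
    ⟨hA.continuous, hA.entry, fun f _ => hA.tangent f (mem_univ f)⟩
  exact hasMoleculeAA hn hκ h0.ne h1 (hS _) (hS _) 0 fun a => by rw [pow_zero, mul_one]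

theorem hasMoleculeAA_of_pos (hn : 0 < n) (hκ : 0 < κ) (h0 : 0 < h) :
    HasMoleculeAA n (-κ ^ 2) h !![1, (n : ℤ); 0, -1] := by
  have h1 : -κ ^ 2 / 2 < h := by nlinarith
  refine hasMoleculeAA hn hκ h0.ne' h1 (isEntryBranch_of_pos h0 (Or.inl rfl))
    (isEntryBranch_of_pos h0 (Or.inr rfl)) n fun a => ?_
  rw [← gauge_add_two_pi hn]
  congr 1
  push_cast
  ring

end

section

/-! ### The isoenergy surfaces as manifolds -/

variable {n : ℕ} {κ h : ℝ}

/-- Coordinates on the states of energy `h` that separate exactly the points of the isoenergy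
surface identify the surface with their range. -/
theorem exists_homeomorph_isoenergy {T : Type*} [TopologicalSpace T] [T2Space T]
    {q : {a : PrePhase n // pNrg κ a = h} → T} (hq : Continuous q) (hs : Function.Surjective q)
    (hinj : ∀ a b, q a = q b → (Quot.mk _ a.1 : Phase n) = Quot.mk _ b.1)
    (hglue : ∀ a b, Glue (finRotate n) a.1 b.1 → q a = q b) :
    Nonempty (Isoenergy n (-κ ^ 2) h ≃ₜ T) := by
  have hc : IsCompact {a : PrePhase n | pNrg κ a = h} :=
    (isCompact_pNrg_le κ h).of_isClosed_subset (isClosed_eq continuous_pNrg continuous_const)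
      fun a ha => le_of_eq ha
  have : CompactSpace {a : PrePhase n // pNrg κ a = h} := isCompact_iff_compactSpace.1 hc
  have hj : Continuous fun a : {a : PrePhase n // pNrg κ a = h} => (Quot.mk _ a.1 : Phase n) :=
    continuous_quot_mk.comp continuous_subtype_val
  obtain ⟨V, hV, hVr, -⟩ := exists_isEmbedding_of_quotient hq hs hj (fun a b => by
      refine ⟨hinj a b, fun hab => ?_⟩
      classical
      have := eq_of_mk_eq (P := fun a => pNrg κ a = h)
        (Q := fun a => if ha : pNrg κ a = h then some (q ⟨a, ha⟩) else none)
        (fun a b hg => by rw [hg.pNrg_eq]) (fun a b hg ha => ?_) hab a.2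
      · simpa [a.2, b.2] using this
      · have hb : pNrg κ b = h := hg.pNrg_eq.trans ha
        simp only [ha, hb, dif_pos]
        exact congrArg some (hglue ⟨a, ha⟩ ⟨b, hb⟩ hg))
  have hr : range V = {P | (momentum n (-κ ^ 2) P).1 = h} := by
    rw [hVr]
    ext P
    constructor
    · rintro ⟨a, rfl⟩
      exact a.2
    · induction P using Quot.ind with
      | mk a => exact fun ha => ⟨⟨a, ha⟩, rfl⟩
  exact ⟨((hV.toHomeomorph).trans (Homeomorph.setCongr hr)).symm⟩

theorem pImp_div_sq_add (h1 : -κ ^ 2 / 2 < h) {a : PrePhase n} (ha : pNrg κ a = h) :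
    (pImp κ a / maxAng κ h) ^ 2 + (pAng a / maxAng κ h) ^ 2 = 1 := by
  have hm := (maxAng_pos h1).ne'
  field_simp
  exact pImp_sq_add h1 ha

/-- The point of the unit sphere whose height is the normalized angular momentum and whose longitude
is the progress. -/
def spherePoint (h1 : -κ ^ 2 / 2 < h) (a : {a : PrePhase n // pNrg κ a = h}) : S2 :=
  ⟨!₂[(diskCoord κ a.1 : ℂ).re, (diskCoord κ a.1 : ℂ).im, pAng a.1 / maxAng κ h], by
    rw [mem_sphere_zero_iff_norm, EuclideanSpace.norm_eq, Real.sqrt_eq_one, Fin.sum_univ_three]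
    simp only [Real.norm_eq_abs, sq_abs]
    have e := sq_norm_eq (diskCoord κ a.1)
    rw [norm_diskCoord, a.2] at e
    have := pImp_div_sq_add h1 a.2
    rw [e] at this
    simpa using this⟩

theorem continuous_spherePoint (h1 : -κ ^ 2 / 2 < h) :
    Continuous (spherePoint h1 : {a : PrePhase n // pNrg κ a = h} → S2) := by
  have hd : Continuous fun a : {a : PrePhase n // pNrg κ a = h} => (diskCoord κ a.1 : ℂ) :=
    continuous_subtype_val.comp (continuousOn_diskCoord h1).domRestrict
  have h2 := continuous_pAng (n := n)
  refine Continuous.subtype_mk ((PiLp.continuous_toLp 2 _).comp (continuous_pi fun i => ?_)) _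
  fin_cases i
  · exact Complex.continuous_re.comp hd
  · exact Complex.continuous_im.comp hd
  · exact (h2.comp continuous_subtype_val).div_const _

/-- For negative energies the rotation angle is globally defined, so that the isoenergy surface is
the product of a circle and a sphere. -/
theorem isoenergy_homeomorph_of_neg (hn : 0 < n) (hκ : 0 < κ) (h1 : -κ ^ 2 / 2 < h) (h0 : h < 0) :
    Nonempty (Isoenergy n (-κ ^ 2) h ≃ₜ Circle × S2) := by
  have hA := isEntryBranch_of_neg hκ h0
  set A : ℝ → ℝ := fun f => Complex.arg ⟨κ - impact κ h f, f⟩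
  have hm := maxAng_pos h1
  have hcoord : ∀ a b : {a : PrePhase n // pNrg κ a = h}, spherePoint h1 a = spherePoint h1 b →
      diskCoord κ a.1 = diskCoord κ b.1 ∧ pAng a.1 = pAng b.1 := by
    intro a b hab
    have e := congrArg Subtype.val hab
    have e0 := congrFun (congrArg WithLp.ofLp e) 0
    have e1 := congrFun (congrArg WithLp.ofLp e) 1
    have e2 := congrFun (congrArg WithLp.ofLp e) 2
    simp only [spherePoint] at e0 e1 e2
    refine ⟨Subtype.ext (Complex.ext ?_ ?_), ?_⟩
    · simpa using e0
    · simpa using e1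
    · simpa [div_left_inj' hm.ne'] using e2
  refine exists_homeomorph_isoenergy
    (q := fun a => (gauge κ (A (pAng a.1)) a.1, spherePoint h1 a)) ?_ ?_ ?_ ?_
  · exact (((hA.continuousOn_gauge hκ h0.ne).mono fun a ha =>
      ⟨ha, fun _ => mem_univ _⟩).domRestrict).prodMk (continuous_spherePoint h1)
  · rintro ⟨z, s⟩
    set d : ℂ := ⟨s.1 0, s.1 1⟩
    have hs : s.1 0 ^ 2 + s.1 1 ^ 2 + s.1 2 ^ 2 = 1 := by
      have := mem_sphere_zero_iff_norm.1 s.2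
      rw [EuclideanSpace.norm_eq, Real.sqrt_eq_one, Fin.sum_univ_three] at this
      simpa using this
    have hd : ‖d‖ ^ 2 = s.1 0 ^ 2 + s.1 1 ^ 2 := sq_norm_eq d
    have hdisc : 2 * h + κ ^ 2 - (maxAng κ h * s.1 2) ^ 2 = (maxAng κ h * ‖d‖) ^ 2 := by
      rw [← maxAng_sq h1, mul_pow, mul_pow, hd]
      linear_combination -maxAng κ h ^ 2 * hs
    have hi : impact κ h (maxAng κ h * s.1 2) = maxAng κ h * ‖d‖ := by
      rw [impact, hdisc, Real.sqrt_sq (by positivity)]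
    obtain ⟨a, e1, e2, e3, e4⟩ := hA.exists_state hn hκ h0.ne (f := maxAng κ h * s.1 2)
      (hdisc ▸ sq_nonneg _) (fun _ => mem_univ _) z (dir d)
    refine ⟨⟨a, e1⟩, Prod.ext e3 (Subtype.ext ?_)⟩
    have hdc : (diskCoord κ a : ℂ) = d := by
      simp only [diskCoord, pImp, e1, e2, hi]
      rw [smul_smul, inv_mul_cancel_left₀ hm.ne']
      by_cases hd0 : d = 0
      · rw [hd0]; simp
      · rw [e4 (by rw [hi]; exact mul_ne_zero hm.ne' (norm_ne_zero_iff.2 hd0)), Complex.real_smul,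
          norm_mul_dir]
    ext i
    simp only [spherePoint, hdc, e2, mul_div_cancel_left₀ _ hm.ne']
    fin_cases i <;> rfl
  · intro a b hab
    obtain ⟨hg, hs⟩ := Prod.mk.inj hab
    obtain ⟨hd, hf⟩ := hcoord a b hs
    exact hA.mk_eq hκ h0.ne a.2 b.2 hf (fun _ => mem_univ _)
      (eq_of_diskCoord_eq h1 a.2 b.2 hd).2 hg
  · intro a b hg
    refine Prod.ext (hA.gauge_eq hκ h0.ne hg a.2 fun _ => mem_univ _) (Subtype.ext ?_)
    simp only [spherePoint, hg.diskCoord_eq (κ := κ), hg.pAng_eq]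

/-! ### The lens space -/

/-- Functions on the three-sphere that separate exactly the orbits of the diagonal action of the
`n`-th roots of unity. -/
def lensInvariants (n : ℕ) (z : S3) : ℂ × ℂ × ℂ × ℝ :=
  (z.1.1 ^ n, z.1.2 ^ n, z.1.1 * starRingEnd ℂ z.1.2, ‖z.1.1‖ ^ 2 - ‖z.1.2‖ ^ 2)

theorem continuous_lensInvariants (n : ℕ) : Continuous (lensInvariants n) := by
  have := Complex.continuous_conj
  unfold lensInvariants
  fun_prop

theorem lensInvariants_eq_of_rel {n : ℕ} (hn : 0 < n) {a b : S3}
    (hr : ∃ ζ : ℂ, ζ ^ n = 1 ∧ b.1.1 = ζ * a.1.1 ∧ b.1.2 = ζ ^ 1 * a.1.2) :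
    lensInvariants n a = lensInvariants n b := by
  obtain ⟨ζ, hζ, h1, h2⟩ := hr
  have hnorm : ‖ζ‖ = 1 := Complex.norm_eq_one_of_pow_eq_one hζ hn.ne'
  have hc : ζ * starRingEnd ℂ ζ = 1 := by rw [Complex.mul_conj', hnorm]; norm_num
  rw [pow_one] at h2
  simp only [lensInvariants, h1, h2, mul_pow, hζ, one_mul, norm_mul, hnorm, map_mul]
  refine Prod.ext rfl (Prod.ext rfl (Prod.ext ?_ rfl))
  simp only
  linear_combination (-(a.1.1 * starRingEnd ℂ a.1.2)) * hc

theorem rel_of_lensInvariants_eq {n : ℕ} {a b : S3} (h : lensInvariants n a = lensInvariants n b) :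
    ∃ ζ : ℂ, ζ ^ n = 1 ∧ b.1.1 = ζ * a.1.1 ∧ b.1.2 = ζ ^ 1 * a.1.2 := by
  obtain ⟨⟨z, w⟩, ha⟩ := a
  obtain ⟨⟨z', w'⟩, hb⟩ := b
  simp only [lensInvariants, Prod.mk.injEq] at h ha hb ⊢
  obtain ⟨hz, hw, hzw, hd⟩ := h
  have nz : ‖z'‖ = ‖z‖ := (sq_eq_sq₀ (norm_nonneg _) (norm_nonneg _)).1 (by linarith)
  have nw : ‖w'‖ = ‖w‖ := (sq_eq_sq₀ (norm_nonneg _) (norm_nonneg _)).1 (by linarith)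
  simp only [pow_one]
  by_cases hz0 : z = 0
  · subst hz0
    have hz' : z' = 0 := by rw [← norm_eq_zero, nz, norm_zero]
    have hw0 : w ≠ 0 := by
      rintro rfl
      simp at ha
    refine ⟨w' / w, ?_, by simp [hz'], by field_simp⟩
    rw [div_pow, ← hw, div_self (pow_ne_zero _ hw0)]
  · refine ⟨z' / z, ?_, by field_simp, ?_⟩
    · rw [div_pow, ← hz, div_self (pow_ne_zero _ hz0)]
    · have hz'0 : z' ≠ 0 := by rw [← norm_ne_zero_iff, nz]; exact norm_ne_zero_iff.2 hz0
      have hc := congrArg (starRingEnd ℂ) hzw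
      simp only [map_mul, Complex.conj_conj] at hc
      have e1 : starRingEnd ℂ z * z = starRingEnd ℂ z' * z' := by
        rw [Complex.conj_mul', Complex.conj_mul', nz]
      have hcz : starRingEnd ℂ z' ≠ 0 := by simpa using hz'0
      field_simp
      apply mul_left_cancel₀ hcz
      linear_combination -z * hc + w * e1

instance : CompactSpace S3 := by
  suffices hc : IsCompact {z : ℂ × ℂ | ‖z.1‖ ^ 2 + ‖z.2‖ ^ 2 = 1} from
    isCompact_iff_compactSpace.1 hc
  refine (isCompact_closedBall (0 : ℂ × ℂ) 1).of_isClosed_subset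
    (isClosed_eq (by fun_prop) (by fun_prop)) fun z hz => ?_
  have hz : ‖z.1‖ ^ 2 + ‖z.2‖ ^ 2 = 1 := hz
  rw [mem_closedBall_zero_iff, Prod.norm_def]
  apply max_le <;> nlinarith [norm_nonneg z.1, norm_nonneg z.2]

theorem exists_homeomorph_lensSpace (hn : 0 < n) :
    Nonempty (LensSpace n 1 ≃ₜ range (lensInvariants n)) := by
  have hc : CompactSpace (LensSpace n 1) := Quot.compactSpace
  set φ : LensSpace n 1 → ℂ × ℂ × ℂ × ℝ :=
    Quot.lift (lensInvariants n) fun a b hr => lensInvariants_eq_of_rel hn hr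
  have hφ : IsClosedEmbedding φ := by
    refine (continuous_quot_lift _ (continuous_lensInvariants n)).isClosedEmbedding ?_
    rintro ⟨a⟩ ⟨b⟩ hab
    exact Quot.sound (rel_of_lensInvariants_eq hab)
  have hr : range φ = range (lensInvariants n) := by
    ext p
    constructor
    · rintro ⟨⟨a⟩, rfl⟩
      exact ⟨a, rfl⟩
    · rintro ⟨a, rfl⟩
      exact ⟨Quot.mk _ a, rfl⟩
  exact ⟨hφ.isEmbedding.toHomeomorph.trans (Homeomorph.setCongr hr)⟩

/-- The modulus of the first (`ε = 1`) or second (`ε = -1`) coordinate in the three-sphere. -/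
def weight (κ h : ℝ) (ε : ℤ) (a : PrePhase n) : ℝ := √((1 + ε * (pAng a / maxAng κ h)) / 2)

theorem continuous_weight (ε : ℤ) : Continuous (weight κ h ε : PrePhase n → ℝ) := by
  have := continuous_pAng (n := n)
  unfold weight
  fun_prop

theorem abs_pAng_div_le (h1 : -κ ^ 2 / 2 < h) {a : PrePhase n} (ha : pNrg κ a = h) :
    |pAng a / maxAng κ h| ≤ 1 := by
  have := pImp_div_sq_add h1 ha
  exact abs_le_one_iff_mul_self_le_one.2 (by nlinarith [sq_nonneg (pImp κ a / maxAng κ h)])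

theorem weight_sq (h1 : -κ ^ 2 / 2 < h) {a : PrePhase n} (ha : pNrg κ a = h) {ε : ℤ}
    (hε : ε = 1 ∨ ε = -1) : weight κ h ε a ^ 2 = (1 + ε * (pAng a / maxAng κ h)) / 2 := by
  obtain ⟨h2, h3⟩ := abs_le.1 (abs_pAng_div_le h1 ha)
  refine Real.sq_sqrt ?_
  rcases hε with rfl | rfl <;> push_cast <;> linarith

/-- The product of the weights is half the modulus of the meridian disk coordinate. -/
theorem weight_mul_weight (h1 : -κ ^ 2 / 2 < h) {a : PrePhase n} (ha : pNrg κ a = h) :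
    weight κ h 1 a * weight κ h (-1) a = pImp κ a / maxAng κ h / 2 := by
  have hm := maxAng_pos h1
  have hp := pImp_nonneg (κ := κ) a
  have hw : 0 ≤ weight κ h 1 a * weight κ h (-1) a :=
    mul_nonneg (Real.sqrt_nonneg _) (Real.sqrt_nonneg _)
  refine (sq_eq_sq₀ hw (by positivity)).1 ?_
  rw [mul_pow, weight_sq h1 ha (Or.inl rfl), weight_sq h1 ha (Or.inr rfl)]
  push_cast
  linear_combination -(pImp_div_sq_add h1 ha) / 4

/-- A tangent state at which the weight `ε` does not vanish has angular momentum of sign `ε`, so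
that the branch `ε` of the rotation angle is continuous there. -/
theorem sign_mul_nonneg_of_weight_ne_zero (h1 : -κ ^ 2 / 2 < h) {a : PrePhase n}
    (ha : pNrg κ a = h) {ε : ℤ} (hε : ε = 1 ∨ ε = -1) (hw : weight κ h ε a ≠ 0)
    (hi : pImp κ a = 0) : 0 ≤ ε * pAng a := by
  have hm := maxAng_pos h1
  have h2 := pImp_div_sq_add h1 ha
  have h3 := weight_sq h1 ha hε
  set t := pAng a / maxAng κ h
  have hεε : (ε : ℝ) * ε = 1 := by rcases hε with rfl | rfl <;> norm_num
  rw [hi, zero_div] at h2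
  have h4 : (ε * t - 1) * (ε * t + 1) = 0 := by
    linear_combination h2 + t ^ 2 * hεε
  have h5 : ε * t + 1 ≠ 0 := by
    intro h6
    apply hw
    rw [← sq_eq_zero_iff, h3]
    linarith
  have h6 : ε * t = 1 := by linarith [(mul_eq_zero.1 h4).resolve_right h5]
  have h7 : ε * pAng a = maxAng κ h := by
    have : pAng a = t * maxAng κ h := by simp only [t]; field_simp
    rw [this, ← mul_assoc, h6, one_mul]
  rw [h7]
  exact hm.le

/-- The branch of the entry angle for positive energy that is adapted to the sign `ε` of the angular
momentum. -/
def posBranch (κ h : ℝ) (ε : ℤ) (f : ℝ) : ℝ :=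
  Complex.arg (-⟨κ - impact κ h f, f⟩) + ε * Real.pi

/-- The invariants of the point of the lens space that corresponds to a state. The rotation angle of
either branch is undefined on one circle of tangent states, where its weight vanishes. -/
def stateInvariants (κ h : ℝ) (a : PrePhase n) : ℂ × ℂ × ℂ × ℝ :=
  (weight κ h 1 a ^ n • (gauge κ (posBranch κ h 1 (pAng a)) a : ℂ),
    weight κ h (-1) a ^ n • (gauge κ (posBranch κ h (-1) (pAng a)) a : ℂ),
    (1 / 2 : ℝ) • (diskCoord κ a : ℂ), pAng a / maxAng κ h)

section Positive

theorem gauge_posBranch_one (hn : 0 < n) (a : PrePhase n) (f : ℝ) :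
    gauge κ (posBranch κ h 1 f) a = gauge κ (posBranch κ h (-1) f) a * phase κ a ^ n := by
  rw [← gauge_add_two_pi hn]
  congr 1
  simp only [posBranch]
  push_cast
  ring

theorem neg_half_sq_lt (h0 : 0 < h) : -κ ^ 2 / 2 < h := by nlinarith [sq_nonneg κ]

theorem continuousOn_weight_smul_gauge (hn : 0 < n) (hκ : 0 < κ) (h0 : 0 < h) {ε : ℤ}
    (hε : ε = 1 ∨ ε = -1) :
    ContinuousOn (fun a : PrePhase n =>
      weight κ h ε a ^ n • (gauge κ (posBranch κ h ε (pAng a)) a : ℂ)) {a | pNrg κ a = h} := by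
  have hA : IsEntryBranch κ h _ (posBranch κ h ε) := isEntryBranch_of_pos h0 hε
  have hset : {a : PrePhase n | pNrg κ a = h ∧ weight κ h ε a ≠ 0} ⊆
      {a | pNrg κ a = h ∧ (pImp κ a = 0 → pAng a ∈ {f : ℝ | 0 ≤ ε * f})} := fun a ha =>
    ⟨ha.1, sign_mul_nonneg_of_weight_ne_zero (neg_half_sq_lt h0) ha.1 hε ha.2⟩
  intro a ha
  refine continuousWithinAt_smul_of_bounded 1 ((continuous_weight ε).pow n).continuousWithinAt
    (fun b => (Circle.norm_coe _).le) fun hw => ?_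
  have hw' : weight κ h ε a ≠ 0 := fun hz => hw (by rw [hz, zero_pow hn.ne'])
  have hc := (hA.continuousOn_gauge hκ h0.ne').mono hset a ⟨ha, hw'⟩
  have hc' : ContinuousWithinAt (fun a : PrePhase n => gauge κ (posBranch κ h ε (pAng a)) a)
      {a | pNrg κ a = h} a := by
    refine hc.mono_of_mem_nhdsWithin ?_
    exact Filter.inter_mem self_mem_nhdsWithin
      (mem_nhdsWithin_of_mem_nhds ((continuous_weight ε).continuousAt.eventually_ne hw'))
  exact isEmbedding_circle_coe.continuous.continuousAt.comp_continuousWithinAt hc'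

theorem Glue.weight_eq {ε : ℤ} {a b : PrePhase n} (hg : Glue (finRotate n) a b) :
    weight κ h ε a = weight κ h ε b := by
  rw [weight, weight, hg.pAng_eq]

theorem Glue.weight_smul_gauge_eq (hn : 0 < n) (hκ : 0 < κ) (h0 : 0 < h) {ε : ℤ}
    (hε : ε = 1 ∨ ε = -1) {a b : PrePhase n} (hg : Glue (finRotate n) a b) (ha : pNrg κ a = h) :
    weight κ h ε a ^ n • (gauge κ (posBranch κ h ε (pAng a)) a : ℂ) =
      weight κ h ε b ^ n • (gauge κ (posBranch κ h ε (pAng b)) b : ℂ) := by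
  have hA : IsEntryBranch κ h _ (posBranch κ h ε) := isEntryBranch_of_pos h0 hε
  rw [← hg.weight_eq]
  by_cases hw : weight κ h ε a = 0
  · rw [hw, zero_pow hn.ne', zero_smul, zero_smul]
  · rw [hA.gauge_eq hκ h0.ne' hg ha
      (sign_mul_nonneg_of_weight_ne_zero (neg_half_sq_lt h0) ha hε hw)]

theorem mk_eq_of_stateInvariants_eq (hκ : 0 < κ) (h0 : 0 < h) {a b : PrePhase n}
    (ha : pNrg κ a = h) (hb : pNrg κ b = h) (hab : stateInvariants κ h a = stateInvariants κ h b) :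
    (Quot.mk _ a : Phase n) = Quot.mk _ b := by
  have h1 : -κ ^ 2 / 2 < h := neg_half_sq_lt h0
  have hm := maxAng_pos h1
  simp only [stateInvariants, Prod.mk.injEq] at hab
  obtain ⟨e1, e2, e3, e4⟩ := hab
  have hd : diskCoord κ a = diskCoord κ b :=
    Subtype.ext (smul_right_injective ℂ (by norm_num : (1 / 2 : ℝ) ≠ 0) e3)
  have hf : pAng a = pAng b := (div_left_inj' hm.ne').1 e4
  have hp := (eq_of_diskCoord_eq h1 ha hb hd).2
  -- the branch that belongs to the sign of the angular momentum separates the points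
  have key : ∀ ε : ℤ, (ε = 1 ∨ ε = -1) → 0 ≤ ε * pAng a →
      weight κ h ε a ^ n • (gauge κ (posBranch κ h ε (pAng a)) a : ℂ) =
        weight κ h ε b ^ n • (gauge κ (posBranch κ h ε (pAng b)) b : ℂ) →
      (Quot.mk _ a : Phase n) = Quot.mk _ b := by
    intro ε hε hs he
    have hA : IsEntryBranch κ h _ (posBranch κ h ε) := isEntryBranch_of_pos h0 hε
    have hw : 0 < weight κ h ε a := by
      refine Real.sqrt_pos.2 ?_
      have := div_nonneg hs hm.le
      rw [mul_div_assoc] at this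
      linarith
    have := (smul_circle_inj (pow_nonneg hw.le n) (pow_nonneg (Real.sqrt_nonneg _) n) he).2
      (pow_pos hw n).ne'
    exact hA.mk_eq hκ h0.ne' ha hb hf (fun _ => hs) hp this
  rcases le_total 0 (pAng a) with hs | hs
  · exact key 1 (Or.inl rfl) (by simpa using hs) e1
  · exact key (-1) (Or.inr rfl) (by simpa using hs) e2

/-- The invariants of a state are those of the point `(α y ω, β ω)` of the three-sphere, where
`α`, `β` are the weights, `y` is the progress and `ω` is an `n`-th root of the rotation angle. -/
theorem stateInvariants_mem_range (hn : 0 < n) (h0 : 0 < h) {a : PrePhase n}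
    (ha : pNrg κ a = h) : stateInvariants κ h a ∈ range (lensInvariants n) := by
  have h1 : -κ ^ 2 / 2 < h := neg_half_sq_lt h0
  obtain ⟨ω, hω⟩ := exists_pow_eq hn (gauge κ (posBranch κ h (-1) (pAng a)) a)
  have w1 : 0 ≤ weight κ h 1 a := Real.sqrt_nonneg _
  have w2 : 0 ≤ weight κ h (-1) a := Real.sqrt_nonneg _
  have s1 := weight_sq h1 ha (Or.inl rfl)
  have s2 := weight_sq h1 ha (Or.inr rfl)
  have hprod := weight_mul_weight h1 ha
  push_cast at s1 s2
  refine ⟨⟨((weight κ h 1 a : ℂ) * (phase κ a * ω), (weight κ h (-1) a : ℂ) * ω), ?_⟩, ?_⟩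
  · simp only [norm_mul, Circle.norm_coe, Complex.norm_real, Real.norm_eq_abs, abs_of_nonneg w1,
      abs_of_nonneg w2, mul_one]
    linarith
  · simp only [lensInvariants, stateInvariants]
    refine Prod.ext ?_ (Prod.ext ?_ (Prod.ext ?_ ?_))
    · simp only
      rw [gauge_posBranch_one hn, ← hω, mul_pow, mul_pow, Complex.real_smul]
      push_cast
      ring
    · simp only
      rw [← hω, mul_pow, Complex.real_smul]
      push_cast
      ring
    · have hc : (ω : ℂ) * starRingEnd ℂ (ω : ℂ) = 1 := by
        rw [Complex.mul_conj', Circle.norm_coe]; norm_num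
      have hp' : (weight κ h 1 a : ℂ) * weight κ h (-1) a = (pImp κ a / maxAng κ h / 2 : ℝ) := by
        rw [← hprod]; push_cast; rfl
      simp only [map_mul, Complex.conj_ofReal, diskCoord, ha, Complex.real_smul]
      push_cast at hp' ⊢
      linear_combination (weight κ h 1 a * weight κ h (-1) a * phase κ a : ℂ) * hc +
        (phase κ a : ℂ) * hp'
    · simp only [norm_mul, Circle.norm_coe, Complex.norm_real, Real.norm_eq_abs, abs_of_nonneg w1,
        abs_of_nonneg w2, mul_one]
      linarith

/-- The point `(z, w)` of the three-sphere corresponds to the state with weights `|z|`, `|w|`,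
progress `(z / |z|) / (w / |w|)` and rotation angles `(z / |z|) ^ n`, `(w / |w|) ^ n`. -/
theorem exists_stateInvariants_eq (hn : 0 < n) (hκ : 0 < κ) (h0 : 0 < h) (z : S3) :
    ∃ a : PrePhase n, pNrg κ a = h ∧ stateInvariants κ h a = lensInvariants n z := by
  have h1 : -κ ^ 2 / 2 < h := neg_half_sq_lt h0
  have hm := maxAng_pos h1
  have hm2 := maxAng_sq h1
  obtain ⟨⟨z, w⟩, hzw⟩ := z
  simp only at hzw
  have hAp : IsEntryBranch κ h _ (posBranch κ h 1) := isEntryBranch_of_pos h0 (Or.inl rfl)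
  have hAm : IsEntryBranch κ h _ (posBranch κ h (-1)) := isEntryBranch_of_pos h0 (Or.inr rfl)
  set f : ℝ := maxAng κ h * (‖z‖ ^ 2 - ‖w‖ ^ 2)
  have hdisc : 2 * h + κ ^ 2 - f ^ 2 = (maxAng κ h * (2 * (‖z‖ * ‖w‖))) ^ 2 := by
    have : (‖z‖ ^ 2 - ‖w‖ ^ 2) ^ 2 = 1 - 4 * (‖z‖ * ‖w‖) ^ 2 := by
      linear_combination (‖z‖ ^ 2 + ‖w‖ ^ 2 + 1) * hzw
    rw [← hm2]
    simp only [f, mul_pow, this]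
    ring
  have hi : impact κ h f = maxAng κ h * (2 * (‖z‖ * ‖w‖)) := by
    rw [impact, hdisc, Real.sqrt_sq (by positivity)]
  -- the state with these weights; on the two critical circles only one of the branches is used
  have hex : ∃ a : PrePhase n, pNrg κ a = h ∧ pAng a = f ∧
      (z ≠ 0 → gauge κ (posBranch κ h 1 (pAng a)) a = dir z ^ n) ∧
      (w ≠ 0 → gauge κ (posBranch κ h (-1) (pAng a)) a = dir w ^ n) ∧
      (z ≠ 0 → w ≠ 0 → phase κ a = dir z * (dir w)⁻¹) := by
    by_cases hw : w = 0
    · obtain ⟨a, e1, e2, e3, -⟩ := hAp.exists_state hn hκ h0.ne' (f := f) (hdisc ▸ sq_nonneg _)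
        (fun _ => by
          have : 0 ≤ f := by
            simp only [f, hw, norm_zero]
            nlinarith [mul_nonneg hm.le (sq_nonneg ‖z‖)]
          simpa using this) (dir z ^ n) 1
      exact ⟨a, e1, e2, fun _ => e3, fun h => absurd hw h, fun _ h => absurd hw h⟩
    · obtain ⟨a, e1, e2, e3, e4⟩ := hAm.exists_state hn hκ h0.ne' (f := f) (hdisc ▸ sq_nonneg _)
        (fun hi0 => by
          have hz : z = 0 := by
            rw [hi] at hi0
            simpa [hm.ne', hw] using hi0
          have : 0 ≤ -f := by
            simp only [f, hz, norm_zero]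
            nlinarith [mul_nonneg hm.le (sq_nonneg ‖w‖)]
          simpa using this) (dir w ^ n) (dir z * (dir w)⁻¹)
      have hp : z ≠ 0 → phase κ a = dir z * (dir w)⁻¹ := fun hz => e4 (by
        rw [hi]
        have := norm_pos_iff.2 hz
        have := norm_pos_iff.2 hw
        positivity)
      refine ⟨a, e1, e2, fun hz => ?_, fun _ => e3, fun hz _ => hp hz⟩
      rw [gauge_posBranch_one hn, e3, hp hz, ← mul_pow, mul_comm, inv_mul_cancel_right]
  obtain ⟨a, e1, e2, e3, e4, e5⟩ := hex
  have hfm : pAng a / maxAng κ h = ‖z‖ ^ 2 - ‖w‖ ^ 2 := by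
    rw [e2]
    simp only [f]
    field_simp
  have hwz : weight κ h 1 a = ‖z‖ := by
    rw [weight, hfm, ← Real.sqrt_sq (norm_nonneg z)]
    congr 1
    push_cast
    rw [Real.sqrt_sq (norm_nonneg z)]
    linarith
  have hww : weight κ h (-1) a = ‖w‖ := by
    rw [weight, hfm, ← Real.sqrt_sq (norm_nonneg w)]
    congr 1
    push_cast
    rw [Real.sqrt_sq (norm_nonneg w)]
    linarith
  have hpow : ∀ (u : ℂ) (g : Circle), (u ≠ 0 → g = dir u ^ n) → ‖u‖ ^ n • (g : ℂ) = u ^ n := by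
    intro u g hg
    by_cases hu : u = 0
    · rw [hu, norm_zero, zero_pow hn.ne', zero_pow hn.ne', zero_smul]
    · rw [hg hu, Circle.coe_pow, Complex.real_smul]
      conv_rhs => rw [← norm_mul_dir u, mul_pow]
      push_cast
      rfl
  refine ⟨a, e1, Prod.ext ?_ (Prod.ext ?_ (Prod.ext ?_ ?_))⟩
  · simp only [stateInvariants, lensInvariants, hwz]
    exact hpow _ _ e3
  · simp only [stateInvariants, lensInvariants, hww]
    exact hpow _ _ e4
  · simp only [stateInvariants, lensInvariants, diskCoord, pImp, e1, e2, hi]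
    by_cases hz : z = 0
    · simp [hz]
    by_cases hw : w = 0
    · simp [hw]
    rw [e5 hz hw]
    have hz' := norm_mul_dir z
    have hw' : starRingEnd ℂ w = ‖w‖ * (dir w : ℂ)⁻¹ := by
      rw [← Circle.coe_inv, Circle.coe_inv_eq_conj]
      conv_lhs => rw [← norm_mul_dir w]
      simp
    conv_rhs => rw [← hz', hw']
    have hm' : (maxAng κ h : ℂ) ≠ 0 := by exact_mod_cast hm.ne'
    simp only [Complex.real_smul, Circle.coe_mul, Circle.coe_inv]
    push_cast
    field_simp
  · simp only [stateInvariants, lensInvariants, hfm]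

theorem isoenergy_homeomorph_of_pos (hn : 0 < n) (hκ : 0 < κ) (h0 : 0 < h) :
    Nonempty (Isoenergy n (-κ ^ 2) h ≃ₜ LensSpace n 1) := by
  have h1 : -κ ^ 2 / 2 < h := neg_half_sq_lt h0
  obtain ⟨e⟩ := exists_homeomorph_lensSpace hn
  obtain ⟨e'⟩ : Nonempty (Isoenergy n (-κ ^ 2) h ≃ₜ range (lensInvariants n)) := by
    refine exists_homeomorph_isoenergy
      (q := fun a => ⟨stateInvariants κ h a.1, stateInvariants_mem_range hn h0 a.2⟩) ?_ ?_ ?_ ?_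
    · refine Continuous.subtype_mk ?_ _
      have h2 := continuous_pAng (n := n)
      refine (continuousOn_weight_smul_gauge hn hκ h0 (Or.inl rfl)).domRestrict.prodMk
        ((continuousOn_weight_smul_gauge hn hκ h0 (Or.inr rfl)).domRestrict.prodMk
        (Continuous.prodMk ?_ ?_))
      · exact (continuous_subtype_val.comp
          (continuousOn_diskCoord h1).domRestrict).const_smul (1 / 2 : ℝ)
      · exact (h2.comp continuous_subtype_val).div_const _
    · rintro ⟨_, z, rfl⟩
      obtain ⟨a, ha, he⟩ := exists_stateInvariants_eq hn hκ h0 z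
      exact ⟨⟨a, ha⟩, Subtype.ext he⟩
    · intro a b hab
      exact mk_eq_of_stateInvariants_eq hκ h0 a.2 b.2 (congrArg Subtype.val hab)
    · intro a b hg
      apply Subtype.ext
      simp only [stateInvariants]
      rw [hg.weight_smul_gauge_eq hn hκ h0 (Or.inl rfl) a.2,
        hg.weight_smul_gauge_eq hn hκ h0 (Or.inr rfl) a.2, hg.diskCoord_eq, hg.pAng_eq]
  exact ⟨e'.trans e.symm⟩

end Positive

end

end

end HookeBilliard

theorem mainTheorem2 (n : ℕ) (hn : 0 < n) (k : ℝ) (hk : k < 0) :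
    -- the monodromy label of the singularity over `(0, 0)` equals `n`
    (∀ m : ℕ, HookeBilliard.IsMonodromyLabel (HookeBilliard.momentum n k) (0, 0) m ↔ m = n) ∧
    -- monodromy matrix along every closed path around `(0, 0)` between the branches of the parabola
    (∀ γ : C(unitInterval, ℝ × ℝ), HookeBilliard.TurnsOnceAround (0, 0) γ →
      (∀ t, ((γ t).2 ^ 2 + k) / 2 < (γ t).1) →
      HookeBilliard.HasMonodromy (HookeBilliard.momentum n k) γ !![1, 0; (n : ℤ), 1]) ∧
    -- negative energies
    (∀ h : ℝ, k / 2 < h → h < 0 →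
      (∃ C, HookeBilliard.HasMoleculeAA n k h C ∧
        HookeBilliard.markR C = ⊤ ∧ HookeBilliard.markEps C = 1) ∧
      Nonempty (HookeBilliard.Isoenergy n k h ≃ₜ Circle × HookeBilliard.S2)) ∧
    -- positive energies
    (∀ h : ℝ, 0 < h →
      (∃ C, HookeBilliard.HasMoleculeAA n k h C ∧
        HookeBilliard.markR C = (((1 / n : ℚ) : AddCircle (1 : ℚ)) : WithTop _) ∧
        HookeBilliard.markEps C = 1) ∧
      Nonempty (HookeBilliard.Isoenergy n k h ≃ₜ HookeBilliard.LensSpace n 1)) := by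
  obtain ⟨κ, hκ, rfl⟩ : ∃ κ : ℝ, 0 < κ ∧ k = -κ ^ 2 :=
    ⟨√(-k), Real.sqrt_pos.2 (by linarith), by rw [Real.sq_sqrt (by linarith), neg_neg]⟩
  refine ⟨HookeBilliard.isMonodromyLabel_iff hn hκ,
    fun γ hγ hreg => HookeBilliard.hasMonodromy hn hκ hγ hreg,
    fun h h1 h0 => ⟨⟨_, HookeBilliard.hasMoleculeAA_of_neg hn hκ h1 h0, ?_, ?_⟩,
      HookeBilliard.isoenergy_homeomorph_of_neg hn hκ h1 h0⟩,
    fun h h0 => ⟨⟨_, HookeBilliard.hasMoleculeAA_of_pos hn hκ h0, ?_, ?_⟩,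
      HookeBilliard.isoenergy_homeomorph_of_pos hn hκ h0⟩⟩
  · simp [HookeBilliard.markR]
  · simp [HookeBilliard.markEps]
  · simp [HookeBilliard.markR, hn.ne']
  · simp [HookeBilliard.markEps, hn.ne', Int.sign_natCast_of_ne_zero hn.ne']
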